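/- Let $\mathbb K$ be $\mathbb R$ or $\mathbb C$. For a cardinal $\kappa$ (regarded as the set of all ordinals $\alpha<\kappa$) let $\ell_\infty(\kappa)$ be the Banach space of bounded functions $\kappa\to\mathbb K$ with the supremum norm, let $\ell_\infty^c(\kappa)$ be its subspace $$\ell_\infty^c(\kappa)=\{z\in\ell_\infty(\kappa)\colon z(\alpha)\neq 0\text{ for at most countably many }\alpha<\kappa\},$$ and let $\ell_\infty=\ell_\infty(\mathbb N)$. A subspace of a Banach space $E$ is complemented if it is the range of a bounded linear projection on $E$; isomorphic means linearly homeomorphic. A Banach space $E$ is primary if, whenever $E$ is isomorphic to $Y\oplus Z$ for Banach spaces $Y$ and $Z$ over $\mathbb K$, at least one of $Y$ and $Z$ is isomorphic to $E$. **Theorem.** Let $\lambda$ be an infinite cardinal number. Then every infinite-dimensional complemented subspace of $\ell_\infty^c(\lambda)$ is isomorphic either to $\ell_\infty$ or to $\ell_\infty^c(\kappa)$ for some cardinal $\kappa\leqslant\lambda$. Consequently, $\ell_\infty^c(\lambda)$ is a primary Banach space. -/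

import Mathlib

open scoped ENNReal Cardinal

/-- The space `ℓ_∞^c(ι)`: the subspace of `ℓ_∞(ι)` (bounded scalar functions on the set `ι` with the
supremum norm) of all functions with at most countably many non-zero values. It carries the norm
inherited from `ℓ_∞(ι)`. -/
def ellInftyC (𝕜 : Type*) [RCLike 𝕜] (ι : Type*) : Submodule 𝕜 (lp (fun _ : ι => 𝕜) ∞) where
  carrier := {z | {i : ι | z i ≠ 0}.Countable}
  zero_mem' := by simp
  add_mem' := by
    intro a b ha hb
    refine (Set.Countable.union ha hb).mono ?_
    intro i hi
    by_contra h
    simp only [Set.mem_union, Set.mem_ofPred_eq, not_or, not_not] at h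
    exact hi (by simp [h.1, h.2])
  smul_mem' := by
    intro c a ha
    refine Set.Countable.mono ?_ ha
    intro i hi h
    exact hi (by simp [h])

/-- The space `ℓ_∞^c(κ)` for a cardinal `κ`, which is identified with the set of the ordinals below
the initial ordinal of cardinality `κ`. -/
abbrev ellInftyCard (𝕜 : Type*) [RCLike 𝕜] (κ : Cardinal) :
    Submodule 𝕜 (lp (fun _ : κ.ord.ToType => 𝕜) ∞) :=
  ellInftyC 𝕜 κ.ord.ToType

/-- Two normed spaces are isomorphic when there is a linear homeomorphism between them. -/
def Isomorphic (𝕜 X Y : Type*) [RCLike 𝕜] [NormedAddCommGroup X] [NormedSpace 𝕜 X]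
    [NormedAddCommGroup Y] [NormedSpace 𝕜 Y] : Prop :=
  Nonempty (X ≃L[𝕜] Y)

universe u v w t

/-- `X` is primary when, for all Banach spaces `Y` and `Z`, an isomorphism of `X` with `Y ⊕ Z`
forces `Y` or `Z` to be isomorphic to `X`. The universes of `Y` and `Z` are arbitrary. -/
def IsPrimary (𝕜 : Type t) [RCLike 𝕜] (X : Type u) [NormedAddCommGroup X] [NormedSpace 𝕜 X] :
    Prop :=
  ∀ (Y : Type v) (Z : Type w)
    [NormedAddCommGroup Y] [NormedSpace 𝕜 Y] [CompleteSpace Y]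
    [NormedAddCommGroup Z] [NormedSpace 𝕜 Z] [CompleteSpace Z],
    Isomorphic 𝕜 X (Y × Z) → Isomorphic 𝕜 Y X ∨ Isomorphic 𝕜 Z X

/-! Let `P = u ∘L v` be a projection onto `X`, and let `var P A` be the norm of `P` on functions
supported in `A`. Take a maximal disjoint family `J` of countable sets of variation above `1/2`, and
let `Γ` be its union. Supports are countable, so maximality bounds `P` by `1/2` off `Γ`
(`exists_disjoint_countable_family`). Cutting `X` down to `Γ` is then undone by a Neumann series,
and `X` is complemented in the space over `Γ`, where `#Γ ≤ max #J ℵ₀`.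

Conversely, infinitely many disjoint sets of variation above some `ε` give a complemented copy in
`X` of the space over their index set (`exists_factorization`): Rosenthal's lemma extracts a matrix
with dominant diagonal from `P`. Pełczyński's method (`isomorphic_of_complemented`) turns the two
embeddings into an isomorphism.

If `J` is finite, a disjoint sequence of large variation is still needed, and it exists unless `X`
is finite-dimensional (`finiteDimensional_of_exhaustive`). Without one, the rows of `P` are
controlled by finitely many of them (`exists_finite_control`). These yield a Hilbertian norm on `X`
equivalent to the supremum norm, and Grothendieck's argument on subspaces of `L²` inside `L^∞`
bounds the dimension.

Primariness: if `P + Q = 1`, then `P` or `Q` is uniformly large on `#L` many unit vectors, so the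
factorization applies over `L` itself. -/

/-- The space `ellInftyC`, as a type with its own instances. -/
def EllInftyC (𝕜 : Type*) [RCLike 𝕜] (ι : Type*) : Type _ := ellInftyC 𝕜 ι

/-! ### Coordinatewise operators. -/

namespace EllInftyC

variable {𝕜 : Type*} [RCLike 𝕜] {ι κ : Type*} {V : Type*} [NormedAddCommGroup V] [NormedSpace 𝕜 V]

noncomputable instance : NormedAddCommGroup (EllInftyC 𝕜 ι) :=
  inferInstanceAs (NormedAddCommGroup (ellInftyC 𝕜 ι))

noncomputable instance : NormedSpace 𝕜 (EllInftyC 𝕜 ι) :=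
  inferInstanceAs (NormedSpace 𝕜 (ellInftyC 𝕜 ι))

/-- The identity, as an isomorphism. -/
noncomputable def equiv (𝕜 : Type*) [RCLike 𝕜] (ι : Type*) :
    EllInftyC 𝕜 ι ≃L[𝕜] ellInftyC 𝕜 ι := ContinuousLinearEquiv.refl 𝕜 (ellInftyC 𝕜 ι)

theorem norm_equiv (x : EllInftyC 𝕜 ι) : ‖equiv 𝕜 ι x‖ = ‖x‖ := rfl

/-- The value of an element of `EllInftyC` at a point. -/
def val (x : EllInftyC 𝕜 ι) (i : ι) : 𝕜 := Subtype.val (p := (· ∈ ellInftyC 𝕜 ι)) x i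

instance : CoeFun (EllInftyC 𝕜 ι) fun _ => ι → 𝕜 := ⟨val⟩

theorem ext_apply {x y : EllInftyC 𝕜 ι} (h : ∀ i, x i = y i) : x = y :=
  Subtype.ext (lp.ext (funext h))

theorem countable_support (x : EllInftyC 𝕜 ι) : {i | x i ≠ 0}.Countable :=
  Subtype.prop (p := (· ∈ ellInftyC 𝕜 ι)) x

@[simp] theorem add_apply (x y : EllInftyC 𝕜 ι) (i : ι) : (x + y) i = x i + y i := rfl

@[simp] theorem sub_apply (x y : EllInftyC 𝕜 ι) (i : ι) : (x - y) i = x i - y i := rfl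

@[simp] theorem smul_apply (c : 𝕜) (x : EllInftyC 𝕜 ι) (i : ι) : (c • x) i = c * x i := rfl

@[simp] theorem zero_apply (i : ι) : (0 : EllInftyC 𝕜 ι) i = 0 := rfl

theorem norm_apply_le (x : EllInftyC 𝕜 ι) (i : ι) : ‖x i‖ ≤ ‖x‖ :=
  lp.norm_apply_le_norm ENNReal.top_ne_zero x.1 i

theorem norm_le {x : EllInftyC 𝕜 ι} {C : ℝ} (hC : 0 ≤ C) (h : ∀ i, ‖x i‖ ≤ C) : ‖x‖ ≤ C :=
  lp.norm_le_of_forall_le hC h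

/-- A bounded function with countable support, as an element of `EllInftyC`. -/
def mk (f : ι → 𝕜) (hf : ∃ C, ∀ i, ‖f i‖ ≤ C) (hs : {i | f i ≠ 0}.Countable) : EllInftyC 𝕜 ι :=
  ⟨⟨f, memℓp_infty (by
    obtain ⟨C, hC⟩ := hf
    exact ⟨C, by rintro _ ⟨i, rfl⟩; exact hC i⟩)⟩, hs⟩

@[simp] theorem mk_apply (f : ι → 𝕜) (hf) (hs) (i : ι) : (mk f hf hs) i = f i := rfl

/-- A bounded operator into `EllInftyC`, given by its coordinates. -/
noncomputable def ofCoords (T : V →ₗ[𝕜] (ι → 𝕜)) (hT : ∃ C, ∀ v i, ‖T v i‖ ≤ C * ‖v‖)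
    (hs : ∀ v, {i | T v i ≠ 0}.Countable) : V →L[𝕜] EllInftyC 𝕜 ι :=
  LinearMap.mkContinuousOfExistsBound
    { toFun := fun v => mk (T v) (hT.imp' (fun C => C * ‖v‖) fun _ h i => h v i) (hs v)
      map_add' := fun v w => ext_apply fun i => by simp
      map_smul' := fun c v => ext_apply fun i => by simp }
    (by
      obtain ⟨C, hC⟩ := hT
      refine ⟨max C 0, fun v => norm_le (by positivity) fun i => (hC v i).trans ?_⟩
      gcongr
      exact le_max_left _ _)

@[simp] theorem ofCoords_apply (T : V →ₗ[𝕜] (ι → 𝕜)) (hT) (hs) (v : V) (i : ι) :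
    (ofCoords T hT hs v) i = T v i := rfl

/-- The coordinate functionals. -/
noncomputable def coord (𝕜 : Type*) [RCLike 𝕜] {ι : Type*} (i : ι) : EllInftyC 𝕜 ι →L[𝕜] 𝕜 :=
  LinearMap.mkContinuous
    { toFun := fun x => x i
      map_add' := fun _ _ => rfl
      map_smul' := fun _ _ => rfl } 1 fun x => (norm_apply_le x i).trans_eq (one_mul _).symm

@[simp] theorem coord_apply (i : ι) (x : EllInftyC 𝕜 ι) : coord 𝕜 i x = x i := rfl

/-- The weighted composition operator `z ↦ g · (z ∘ j)`. -/
noncomputable def weightedComp (g : ι → 𝕜) (j : ι → κ) (hg : ∃ C, ∀ i, ‖g i‖ ≤ C)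
    (hj : ∀ k, {i | j i = k ∧ g i ≠ 0}.Countable) : EllInftyC 𝕜 κ →L[𝕜] EllInftyC 𝕜 ι :=
  ofCoords
    { toFun := fun z i => g i * z (j i)
      map_add' := fun x y => funext fun i => by simp [mul_add]
      map_smul' := fun c x => funext fun i => by simp [mul_left_comm] }
    (by
      obtain ⟨C, hC⟩ := hg
      refine ⟨C, fun z i => ?_⟩
      have h0 : 0 ≤ C := (norm_nonneg _).trans (hC i)
      simp only [LinearMap.coe_mk, AddHom.coe_mk, norm_mul]
      exact mul_le_mul (hC i) (norm_apply_le z _) (norm_nonneg _) h0)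
    (fun z => by
      have hz : {k | z k ≠ 0}.Countable := z.countable_support
      refine (hz.biUnion fun k _ => hj k).mono fun i hi => ?_
      simp only [LinearMap.coe_mk, AddHom.coe_mk, ne_eq, mul_eq_zero, not_or,
        Set.mem_ofPred_eq] at hi
      simp only [Set.mem_iUnion, Set.mem_ofPred_eq]
      exact ⟨j i, hi.2, rfl, hi.1⟩)

@[simp] theorem weightedComp_apply (g : ι → 𝕜) (j : ι → κ) (hg) (hj) (z : EllInftyC 𝕜 κ) (i : ι) :
    (weightedComp g j hg hj z) i = g i * z (j i) := rfl

theorem norm_weightedComp_apply_le {g : ι → 𝕜} {j : ι → κ} {hg} {hj} (z : EllInftyC 𝕜 κ) {C : ℝ}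
    (h0 : 0 ≤ C) (hC : ∀ i, ‖g i‖ ≤ C) : ‖weightedComp g j hg hj z‖ ≤ C * ‖z‖ := by
  refine norm_le (by positivity) fun i => ?_
  rw [weightedComp_apply, norm_mul]
  exact mul_le_mul (hC i) (norm_apply_le z _) (norm_nonneg _) h0

/-- Composition with an injective map. -/
noncomputable def restr (𝕜 : Type*) [RCLike 𝕜] {ι κ : Type*} (j : ι ↪ κ) :
    EllInftyC 𝕜 κ →L[𝕜] EllInftyC 𝕜 ι :=
  weightedComp (fun _ => 1) j ⟨1, by simp⟩ fun k =>
    (Set.Subsingleton.countable fun _ hx _ hy => j.injective (hx.1.trans hy.1.symm))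

@[simp] theorem restr_apply (j : ι ↪ κ) (z : EllInftyC 𝕜 κ) (i : ι) :
    (restr 𝕜 j z) i = z (j i) := by simp [restr]

open Classical in
/-- Extension by zero along an injective map. -/
noncomputable def extend (𝕜 : Type*) [RCLike 𝕜] {ι κ : Type*} (j : ι ↪ κ) :
    EllInftyC 𝕜 ι →L[𝕜] EllInftyC 𝕜 κ :=
  ofCoords
    { toFun := fun z k => if h : ∃ i, j i = k then z h.choose else 0
      map_add' := fun x y => funext fun k => by
        by_cases h : ∃ i, j i = k <;> simp [h]
      map_smul' := fun c x => funext fun k => by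
        by_cases h : ∃ i, j i = k <;> simp [h] }
    (⟨1, fun z k => by
      by_cases h : ∃ i, j i = k
      · simpa [h] using norm_apply_le z _
      · simp [h]⟩)
    (fun z => by
      have hz : {k | z k ≠ 0}.Countable := z.countable_support
      refine (hz.image j).mono fun k hk => ?_
      by_cases h : ∃ i, j i = k
      · refine ⟨h.choose, fun h0 => hk ?_, h.choose_spec⟩
        simp [h, h0]
      · exact absurd (by simp [h]) hk)

@[simp] theorem extend_apply_map (j : ι ↪ κ) (z : EllInftyC 𝕜 ι) (i : ι) :
    (extend 𝕜 j z) (j i) = z i := by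
  have h : ∃ i', j i' = j i := ⟨i, rfl⟩
  simp [extend]

theorem extend_apply_of_notMem (j : ι ↪ κ) (z : EllInftyC 𝕜 ι) {k : κ} (hk : k ∉ Set.range j) :
    (extend 𝕜 j z) k = 0 := by
  have h : ¬ ∃ i, j i = k := hk
  simp [extend, h]

@[simp] theorem restr_extend (j : ι ↪ κ) (z : EllInftyC 𝕜 ι) : restr 𝕜 j (extend 𝕜 j z) = z :=
  ext_apply fun i => by simp

theorem norm_extend_le (j : ι ↪ κ) (z : EllInftyC 𝕜 ι) : ‖extend 𝕜 j z‖ ≤ ‖z‖ := by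
  refine norm_le (norm_nonneg _) fun k => ?_
  by_cases h : k ∈ Set.range j
  · obtain ⟨i, rfl⟩ := h
    simpa using norm_apply_le z i
  · simp [extend_apply_of_notMem j z h]

/-- A bijection of the index sets induces an isomorphism. -/
noncomputable def congr (𝕜 : Type*) [RCLike 𝕜] {ι κ : Type*} (e : ι ≃ κ) :
    EllInftyC 𝕜 κ ≃L[𝕜] EllInftyC 𝕜 ι :=
  ContinuousLinearEquiv.equivOfInverse (restr 𝕜 e.toEmbedding) (restr 𝕜 e.symm.toEmbedding)
    (fun z => ext_apply fun i => by simp) (fun z => ext_apply fun i => by simp)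

open Classical in
/-- Multiplication by the indicator function of a set. -/
noncomputable def ind (𝕜 : Type*) [RCLike 𝕜] {ι : Type*} (A : Set ι) :
    EllInftyC 𝕜 ι →L[𝕜] EllInftyC 𝕜 ι :=
  weightedComp (fun i => if i ∈ A then 1 else 0) id
    ⟨1, fun i => by by_cases h : i ∈ A <;> simp [h]⟩
    fun k => (Set.countable_singleton k).mono fun _ h => h.1

theorem ind_apply_of_mem {A : Set ι} {i : ι} (h : i ∈ A) (z : EllInftyC 𝕜 ι) :
    (ind 𝕜 A z) i = z i := by simp [ind, h]

theorem ind_apply_of_notMem {A : Set ι} {i : ι} (h : i ∉ A) (z : EllInftyC 𝕜 ι) :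
    (ind 𝕜 A z) i = 0 := by simp [ind, h]

theorem norm_ind_apply_le (A : Set ι) (z : EllInftyC 𝕜 ι) : ‖ind 𝕜 A z‖ ≤ ‖z‖ := by
  refine norm_le (norm_nonneg _) fun i => ?_
  by_cases h : i ∈ A
  · simpa [ind_apply_of_mem h] using norm_apply_le z i
  · simp [ind_apply_of_notMem h]

theorem ind_ind (A B : Set ι) (z : EllInftyC 𝕜 ι) : ind 𝕜 A (ind 𝕜 B z) = ind 𝕜 (A ∩ B) z := by
  refine ext_apply fun i => ?_
  by_cases hA : i ∈ A <;> by_cases hB : i ∈ B <;> simp [ind, hA, hB]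

theorem ind_eq_self {A : Set ι} {z : EllInftyC 𝕜 ι} (h : ∀ i, z i ≠ 0 → i ∈ A) :
    ind 𝕜 A z = z := by
  refine ext_apply fun i => ?_
  by_cases hA : i ∈ A
  · exact ind_apply_of_mem hA z
  · rw [ind_apply_of_notMem hA, not_imp_comm.1 (h i) hA]

theorem ind_add_ind_compl (A : Set ι) (z : EllInftyC 𝕜 ι) :
    ind 𝕜 A z + ind 𝕜 Aᶜ z = z := by
  refine ext_apply fun i => ?_
  by_cases hA : i ∈ A <;> simp [ind, hA]

/-! ### Variation of operators and functionals. -/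

/-- The variation of an operator on a set: the norm of its restriction to the functions which
are supported by the set. -/
noncomputable def var (T : EllInftyC 𝕜 ι →L[𝕜] V) (A : Set ι) : ℝ := ‖T ∘L ind 𝕜 A‖

variable {T : EllInftyC 𝕜 ι →L[𝕜] V}

theorem var_nonneg (A : Set ι) : 0 ≤ var T A := norm_nonneg _

theorem norm_apply_ind_le (A : Set ι) (z : EllInftyC 𝕜 ι) : ‖T (ind 𝕜 A z)‖ ≤ var T A * ‖z‖ :=
  (T ∘L ind 𝕜 A).le_opNorm z

theorem norm_apply_le_var {A : Set ι} {z : EllInftyC 𝕜 ι} (h : ∀ i, z i ≠ 0 → i ∈ A) :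
    ‖T z‖ ≤ var T A * ‖z‖ := by
  simpa [ind_eq_self h] using norm_apply_ind_le (T := T) A z

theorem var_le {A : Set ι} {C : ℝ} (hC : 0 ≤ C) (h : ∀ z, ‖T (ind 𝕜 A z)‖ ≤ C * ‖z‖) :
    var T A ≤ C := ContinuousLinearMap.opNorm_le_bound _ hC h

theorem exists_of_lt_var {A : Set ι} {C : ℝ} (h : C < var T A) :
    ∃ z : EllInftyC 𝕜 ι, ‖z‖ ≤ 1 ∧ (∀ i, z i ≠ 0 → i ∈ A) ∧ C < ‖T z‖ := by
  obtain ⟨z, hz, hC⟩ := ContinuousLinearMap.exists_lt_apply_of_lt_opNorm _ h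
  refine ⟨ind 𝕜 A z, (norm_ind_apply_le A z).trans hz.le, fun i hi => ?_, hC⟩
  by_contra hA
  exact hi (ind_apply_of_notMem hA z)

theorem var_le_norm (A : Set ι) : var T A ≤ ‖T‖ := var_le (norm_nonneg _) fun z =>
  (T.le_opNorm _).trans (by gcongr; exact norm_ind_apply_le A z)

theorem var_mono {A B : Set ι} (h : A ⊆ B) : var T A ≤ var T B := var_le (var_nonneg B) fun z => by
  have := norm_apply_ind_le (T := T) B (ind 𝕜 A z)
  rw [ind_ind, Set.inter_eq_right.2 h] at this
  exact this.trans (by gcongr; exacts [var_nonneg B, norm_ind_apply_le A z])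

theorem var_union_le (A B : Set ι) : var T (A ∪ B) ≤ var T A + var T B := by
  refine var_le (add_nonneg (var_nonneg _) (var_nonneg _)) fun z => ?_
  have h : ind 𝕜 (A ∪ B) z = ind 𝕜 A z + ind 𝕜 B (ind 𝕜 Aᶜ z) := by
    refine ext_apply fun i => ?_
    by_cases hA : i ∈ A <;> by_cases hB : i ∈ B <;> simp [ind, hA, hB]
  rw [h, map_add, add_mul]
  refine (norm_add_le _ _).trans (add_le_add (norm_apply_ind_le A z) ?_)
  exact (norm_apply_ind_le B _).trans (by gcongr; exacts [var_nonneg B, norm_ind_apply_le _ z])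

theorem exists_phase (a : 𝕜) : ∃ c : 𝕜, ‖c‖ ≤ 1 ∧ c * a = (‖a‖ : 𝕜) := by
  by_cases h : a = 0
  · exact ⟨0, by simp, by simp [h]⟩
  · have h' : (‖a‖ : 𝕜) ≠ 0 := by simpa using h
    refine ⟨(‖a‖ : 𝕜) / a, by simp [h], by field_simp⟩

/-- The variation of a functional is superadditive. -/
theorem var_add_var_le {μ : EllInftyC 𝕜 ι →L[𝕜] 𝕜} {A B C : Set ι} (hd : Disjoint A B)
    (hA : A ⊆ C) (hB : B ⊆ C) : var μ A + var μ B ≤ var μ C := by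
  refine le_of_forall_pos_le_add fun e he => ?_
  obtain ⟨x, hx1, hxA, hx⟩ := exists_of_lt_var (T := μ) (A := A) (sub_lt_self _ (half_pos he))
  obtain ⟨y, hy1, hyB, hy⟩ := exists_of_lt_var (T := μ) (A := B) (sub_lt_self _ (half_pos he))
  -- Rotation makes both values nonnegative, so they add up, while disjoint supports keep the norm
  -- of the sum at most 1.
  obtain ⟨a, ha1, ha⟩ := exists_phase (μ x)
  obtain ⟨b, hb1, hb⟩ := exists_phase (μ y)
  have hw : ‖a • x + b • y‖ ≤ 1 := by
    refine norm_le zero_le_one fun i => ?_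
    have h1 : ‖a‖ * ‖x i‖ ≤ 1 := mul_le_one₀ ha1 (norm_nonneg _) ((norm_apply_le x i).trans hx1)
    have h2 : ‖b‖ * ‖y i‖ ≤ 1 := mul_le_one₀ hb1 (norm_nonneg _) ((norm_apply_le y i).trans hy1)
    by_cases hi : x i = 0
    · simpa [hi] using h2
    · have : y i = 0 := by
        by_contra hyi
        exact Set.disjoint_left.1 hd (hxA i hi) (hyB i hyi)
      simpa [this] using h1
  have hs : ∀ i, (a • x + b • y) i ≠ 0 → i ∈ C := by
    intro i hi
    by_cases hxi : x i = 0
    · refine hB (hyB i fun hyi => hi ?_)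
      simp [hxi, hyi]
    · exact hA (hxA i hxi)
  have h := norm_apply_le_var (T := μ) hs
  rw [map_add, map_smul, map_smul, smul_eq_mul, smul_eq_mul, ha, hb, ← RCLike.ofReal_add,
    RCLike.norm_ofReal, abs_of_nonneg (by positivity)] at h
  have h3 : var μ C * ‖a • x + b • y‖ ≤ var μ C := mul_le_of_le_one_right (var_nonneg _) hw
  linarith

/-- Iterated superadditivity. It bounds the number of points at which a functional has variation at
least `ε`. -/
theorem sum_var_singleton_le (μ : EllInftyC 𝕜 ι →L[𝕜] 𝕜) (s : Finset ι) :
    ∑ i ∈ s, var μ {i} ≤ var μ (s : Set ι) := by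
  classical
  induction s using Finset.induction_on with
  | empty => simpa using var_nonneg _
  | insert a s ha ih =>
    rw [Finset.sum_insert ha]
    refine (add_le_add_right ih _).trans (var_add_var_le ?_ ?_ ?_)
    · simpa using ha
    · simp
    · simp

/-- A limit of a sequence vanishes off the union of the supports, which is countable. -/
instance : CompleteSpace (EllInftyC 𝕜 ι) := by
  suffices h : IsClosed (ellInftyC 𝕜 ι : Set (lp (fun _ : ι => 𝕜) ∞)) from
    IsClosed.completeSpace_coe (hs := h)
  refine isClosed_of_closure_subset fun z hz => ?_
  obtain ⟨x, hx, hlim⟩ := mem_closure_iff_seq_limit.1 hz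
  have hc : (⋃ n, {i | x n i ≠ 0}).Countable := Set.countable_iUnion fun n => hx n
  refine hc.mono fun i hi => ?_
  by_contra h
  simp only [Set.mem_iUnion, Set.mem_ofPred_eq, not_exists, not_not] at h
  have h1 : ∀ n, ‖z i‖ ≤ ‖x n - z‖ := fun n => by
    have := lp.norm_apply_le_norm ENNReal.top_ne_zero (x n - z) i
    simpa [h n] using this
  have h2 := tendsto_iff_norm_sub_tendsto_zero.1 hlim
  exact hi (norm_le_zero_iff.1 (ge_of_tendsto' h2 h1))

end EllInftyC

/-! ### Pełczyński's decomposition method. -/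

namespace EllInftyC

section Pelczynski

variable {𝕜 : Type*} [RCLike 𝕜] {κ : Type*} {X : Type*} [NormedAddCommGroup X] [NormedSpace 𝕜 X]

/-- The `n`-th term of an element of `EllInftyC 𝕜 (ℕ × κ)`, viewed as a sequence. -/
noncomputable def slice (𝕜 : Type*) [RCLike 𝕜] (κ : Type*) (n : ℕ) :
    EllInftyC 𝕜 (ℕ × κ) →L[𝕜] EllInftyC 𝕜 κ :=
  restr 𝕜 ⟨fun k => (n, k), fun _ _ h => (Prod.ext_iff.1 h).2⟩

theorem slice_apply (n : ℕ) (z : EllInftyC 𝕜 (ℕ × κ)) (k : κ) : slice 𝕜 κ n z k = z (n, k) :=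
  restr_apply _ z k

theorem ext_slice {z w : EllInftyC 𝕜 (ℕ × κ)} (h : ∀ n, slice 𝕜 κ n z = slice 𝕜 κ n w) :
    z = w := by
  refine ext_apply fun ⟨n, k⟩ => ?_
  rw [← slice_apply, ← slice_apply, h]

theorem norm_slice_le (n : ℕ) (z : EllInftyC 𝕜 (ℕ × κ)) : ‖slice 𝕜 κ n z‖ ≤ ‖z‖ :=
  norm_le (norm_nonneg _) fun k => by
    rw [slice_apply]
    exact norm_apply_le z _

/-- The operator that acts as `Q` on each term of a sequence. -/
noncomputable def onSlices (Q : EllInftyC 𝕜 κ →L[𝕜] EllInftyC 𝕜 κ) :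
    EllInftyC 𝕜 (ℕ × κ) →L[𝕜] EllInftyC 𝕜 (ℕ × κ) :=
  ofCoords
    { toFun := fun z p => Q (slice 𝕜 κ p.1 z) p.2
      map_add' := fun x y => funext fun p => by simp
      map_smul' := fun c x => funext fun p => by simp }
    ⟨‖Q‖, fun z p => (norm_apply_le _ _).trans ((Q.le_opNorm _).trans
      (by gcongr; exact norm_slice_le _ z))⟩
    (fun z => by
      -- Countably many slices keep the support countable, so all bounded sequences are available
      -- for the swindle.
      have h := Set.countable_iUnion fun n : ℕ =>
        (Q (slice 𝕜 κ n z)).countable_support.image (Prod.mk n)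
      refine h.mono fun p hp => Set.mem_iUnion.2 ⟨p.1, ?_⟩
      exact ⟨p.2, hp, rfl⟩)

theorem slice_onSlices (Q : EllInftyC 𝕜 κ →L[𝕜] EllInftyC 𝕜 κ) (n : ℕ) (z : EllInftyC 𝕜 (ℕ × κ)) :
    slice 𝕜 κ n (onSlices Q z) = Q (slice 𝕜 κ n z) :=
  ext_apply fun k => by rw [slice_apply]; rfl

/-- The shift of the index set of sequences. -/
def succEmb (κ : Type*) : ℕ × κ ↪ ℕ × κ :=
  ⟨fun p => (p.1 + 1, p.2), fun p q h => by
    simp only [Prod.mk.injEq, Nat.add_right_cancel_iff] at h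
    exact Prod.ext h.1 h.2⟩

/-- The embedding of the index set as the set of indices of the initial term. -/
def zeroEmb (κ : Type*) : κ ↪ ℕ × κ := ⟨fun k => (0, k), fun _ _ h => (Prod.ext_iff.1 h).2⟩

theorem slice_restr_succEmb (n : ℕ) (z : EllInftyC 𝕜 (ℕ × κ)) :
    slice 𝕜 κ n (restr 𝕜 (succEmb κ) z) = slice 𝕜 κ (n + 1) z :=
  ext_apply fun k => by rw [slice_apply, slice_apply, restr_apply]; rfl

theorem slice_zero_extend_succEmb (z : EllInftyC 𝕜 (ℕ × κ)) :
    slice 𝕜 κ 0 (extend 𝕜 (succEmb κ) z) = 0 :=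
  ext_apply fun k => by
    rw [slice_apply, extend_apply_of_notMem, zero_apply]
    rintro ⟨p, hp⟩
    exact Nat.succ_ne_zero _ (Prod.ext_iff.1 hp).1

theorem slice_succ_extend_succEmb (n : ℕ) (z : EllInftyC 𝕜 (ℕ × κ)) :
    slice 𝕜 κ (n + 1) (extend 𝕜 (succEmb κ) z) = slice 𝕜 κ n z :=
  ext_apply fun k => by
    rw [slice_apply, slice_apply]
    exact extend_apply_map (succEmb κ) z (n, k)

theorem slice_zero_extend_zeroEmb (z : EllInftyC 𝕜 κ) :
    slice 𝕜 κ 0 (extend 𝕜 (zeroEmb κ) z) = z :=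
  ext_apply fun k => by
    rw [slice_apply]
    exact extend_apply_map (zeroEmb κ) z k

theorem slice_succ_extend_zeroEmb (n : ℕ) (z : EllInftyC 𝕜 κ) :
    slice 𝕜 κ (n + 1) (extend 𝕜 (zeroEmb κ) z) = 0 :=
  ext_apply fun k => by
    rw [slice_apply, extend_apply_of_notMem, zero_apply]
    rintro ⟨p, hp⟩
    exact Nat.succ_ne_zero _ (Prod.ext_iff.1 hp).1.symm

/-- A complemented subspace `X` of `EllInftyC 𝕜 κ` is absorbed by the space of bounded sequences
in `EllInftyC 𝕜 κ`. -/
noncomputable def absorb (u : X →L[𝕜] EllInftyC 𝕜 κ) (v : EllInftyC 𝕜 κ →L[𝕜] X)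
    (h : ∀ x, v (u x) = x) : EllInftyC 𝕜 (ℕ × κ) ≃L[𝕜] X × EllInftyC 𝕜 (ℕ × κ) :=
  -- With `P = u ∘L v`, the map is `z ↦ (v z₀, (P zₙ₊₁ + zₙ - P zₙ)ₙ)`: the `P`-parts move down one
  -- slot, the zeroth into `X`, and the complementary parts stay.
  ContinuousLinearEquiv.equivOfInverse
    ((v ∘L slice 𝕜 κ 0).prod (onSlices (u ∘L v) ∘L restr 𝕜 (succEmb κ) +
      ContinuousLinearMap.id 𝕜 _ - onSlices (u ∘L v)))
    (extend 𝕜 (zeroEmb κ) ∘L u ∘L ContinuousLinearMap.fst 𝕜 _ _ +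
      (extend 𝕜 (succEmb κ) ∘L onSlices (u ∘L v) + ContinuousLinearMap.id 𝕜 _ -
        onSlices (u ∘L v)) ∘L ContinuousLinearMap.snd 𝕜 _ _)
    (fun z => ext_slice fun n => by
      cases n with
      | zero =>
        simp [slice_onSlices, slice_restr_succEmb, slice_zero_extend_succEmb,
          slice_zero_extend_zeroEmb, h]
        abel
      | succ n =>
        simp [slice_onSlices, slice_restr_succEmb, slice_succ_extend_succEmb,
          slice_succ_extend_zeroEmb, h])
    (fun ⟨x, w⟩ => by
      refine Prod.ext ?_ (ext_slice fun n => ?_)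
      · simp [slice_onSlices, slice_zero_extend_succEmb, slice_zero_extend_zeroEmb, h]
      · cases n with
        | zero =>
          simp [slice_onSlices, slice_restr_succEmb, slice_zero_extend_succEmb,
            slice_zero_extend_zeroEmb, slice_succ_extend_zeroEmb, h]
          abel
        | succ n =>
          simp [slice_onSlices, slice_restr_succEmb, slice_succ_extend_succEmb,
            slice_succ_extend_zeroEmb, h])

/-- The decomposition method: if `X` and `EllInftyC 𝕜 κ` are isomorphic to complemented subspaces
of each other, then they are isomorphic. -/
theorem isomorphic_of_complemented [Infinite κ]
    (u : X →L[𝕜] EllInftyC 𝕜 κ) (v : EllInftyC 𝕜 κ →L[𝕜] X) (h : ∀ x, v (u x) = x)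
    (a : EllInftyC 𝕜 κ →L[𝕜] X) (b : X →L[𝕜] EllInftyC 𝕜 κ) (h' : ∀ z, b (a z) = z) :
    Nonempty (X ≃L[𝕜] EllInftyC 𝕜 κ) := by
  have hc : Nonempty (ℕ × κ ≃ κ) := by
    rw [← Cardinal.lift_mk_eq']
    simp
  obtain ⟨e⟩ := hc
  have E : EllInftyC 𝕜 κ ≃L[𝕜] EllInftyC 𝕜 (ℕ × κ) := congr 𝕜 e
  have absorbs : ∀ {Y : Type _} [NormedAddCommGroup Y] [NormedSpace 𝕜 Y]
      (u : Y →L[𝕜] EllInftyC 𝕜 κ) (v : EllInftyC 𝕜 κ →L[𝕜] Y) (_ : ∀ x, v (u x) = x),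
      Nonempty (EllInftyC 𝕜 κ ≃L[𝕜] Y × EllInftyC 𝕜 κ) := fun u v h =>
    ⟨E.trans ((absorb u v h).trans ((ContinuousLinearEquiv.refl 𝕜 _).prodCongr E.symm))⟩
  -- With `Y` the space over `κ` and `W = b.ker`: `X ≃ Y × W ≃ Y × Y × W ≃ Y × X ≃ Y`.
  have F : X ≃L[𝕜] EllInftyC 𝕜 κ × b.ker := ContinuousLinearEquiv.equivOfRightInverse b a h'
  obtain ⟨G⟩ := absorbs u v h
  have H : EllInftyC 𝕜 κ ≃L[𝕜] EllInftyC 𝕜 κ × EllInftyC 𝕜 κ :=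
    E.trans ((absorb (ContinuousLinearMap.id 𝕜 _) (ContinuousLinearMap.id 𝕜 _) fun _ => rfl).trans
      ((ContinuousLinearEquiv.refl 𝕜 _).prodCongr E.symm))
  have I : X ≃L[𝕜] EllInftyC 𝕜 κ × X :=
    F.trans ((H.prodCongr (ContinuousLinearEquiv.refl 𝕜 _)).trans
      ((ContinuousLinearEquiv.prodAssoc 𝕜 _ _ _).trans
        ((ContinuousLinearEquiv.refl 𝕜 _).prodCongr F.symm)))
  exact ⟨I.trans ((ContinuousLinearEquiv.prodComm 𝕜 _ _).trans G.symm)⟩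

end Pelczynski

end EllInftyC

/-! ### Rosenthal's lemma. -/

/-- Rosenthal's disjointification lemma for families of superadditive set functions. -/
theorem exists_embedding_offDiag_le {I : Type*} [Infinite I] (m : I → Set I → ℝ) {C δ : ℝ}
    (h0 : ∀ i A, 0 ≤ m i A) (hC : ∀ i A, m i A ≤ C) (hδ : 0 < δ)
    (hadd : ∀ i A B D, Disjoint A B → A ⊆ D → B ⊆ D → m i A + m i B ≤ m i D) :
    ∃ j : I ↪ I, ∀ i, m (j i) (Set.range j \ {j i}) ≤ δ := by
  have hmono : ∀ i A B, A ⊆ B → m i A ≤ m i B := fun i A B h => by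
    have := hadd i A ∅ B (by simp) h (by simp)
    linarith [h0 i ∅]
  have hII : Nonempty (I × I ≃ I) := by
    rw [← Cardinal.eq]
    simp
  obtain ⟨e⟩ := hII
  -- `n` measures the off-diagonal mass in units of `δ`; each round either succeeds or saves one
  -- unit.
  have key : ∀ (n : ℕ) (j : I ↪ I), (∀ i, m (j i) (Set.range j \ {j i}) ≤ n * δ) →
      ∃ j : I ↪ I, ∀ i, m (j i) (Set.range j \ {j i}) ≤ δ := by
    intro n
    induction n with
    | zero => exact fun j hj => ⟨j, fun i => (hj i).trans (by simpa using hδ.le)⟩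
    | succ n ih =>
      intro j hj
      -- The bijection `I × I ≃ I` cuts the family into `I` many pieces, each again indexed by `I`.
      let piece : I → (I ↪ I) := fun β =>
        ⟨fun i => j (e (β, i)), fun x y h => by simpa using j.injective h⟩
      by_cases hβ : ∃ β, ∀ i, m (piece β i) (Set.range (piece β) \ {piece β i}) ≤ δ
      · obtain ⟨β, hβ⟩ := hβ
        exact ⟨piece β, hβ⟩
      push Not at hβ
      -- If every piece fails, select from each an index with mass above `δ` inside its own piece.
      -- The selected family avoids that mass.
      choose i hi using hβ
      let j' : I ↪ I := ⟨fun β => piece β (i β), fun x y h => by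
        have := e.injective (j.injective h)
        exact (Prod.ext_iff.1 this).1⟩
      refine ih j' fun β => ?_
      have hdisj : Disjoint (Set.range j' \ {j' β}) (Set.range (piece β) \ {piece β (i β)}) := by
        rw [Set.disjoint_left]
        rintro _ ⟨⟨γ, rfl⟩, hγ⟩ ⟨⟨l, hl⟩, -⟩
        have := (Prod.ext_iff.1 (e.injective (j.injective hl))).1
        exact hγ (by simp only at this; subst this; rfl)
      have h1 := hadd (j' β) _ _ (Set.range j \ {j' β}) hdisj
        (by
          rintro _ ⟨⟨γ, rfl⟩, hγ⟩
          exact ⟨⟨_, rfl⟩, hγ⟩)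
        (by
          rintro _ ⟨⟨γ, rfl⟩, hγ⟩
          exact ⟨⟨_, rfl⟩, hγ⟩)
      have h2 : m (j' β) (Set.range j \ {j' β}) ≤ (n + 1 : ℕ) * δ := hj _
      have h3 : δ < m (j' β) (Set.range (piece β) \ {piece β (i β)}) := hi β
      push_cast at h2
      linarith
  obtain ⟨n, hn⟩ := exists_nat_ge (C / δ)
  refine key n (Function.Embedding.refl I) fun i => (hC _ _).trans ?_
  rwa [div_le_iff₀ hδ] at hn

/-! ### Complemented copies inside the range of a projection. -/

namespace EllInftyC

variable {𝕜 : Type*} [RCLike 𝕜] {L K : Type*} {X : Type*} [NormedAddCommGroup X] [NormedSpace 𝕜 X]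

theorem exists_leftInverse_id_sub {E : Type*} [NormedAddCommGroup E] [NormedSpace 𝕜 E]
    [CompleteSpace E] (N : E →L[𝕜] E) (hN : ‖N‖ < 1) :
    ∃ S : E →L[𝕜] E, ∀ x, S (x - N x) = x := by
  refine ⟨↑(Units.oneSub N hN)⁻¹, fun x => ?_⟩
  have := (Units.oneSub N hN).inv_mul
  exact DFunLike.congr_fun this x

/-- An operator whose matrix has a diagonal which is bounded away from zero and dominates the
rest of each row has a left inverse. -/
theorem exists_leftInverse_of_diag (M : EllInftyC 𝕜 K →L[𝕜] EllInftyC 𝕜 K) {ε : ℝ} (hε : 0 < ε)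
    (d : K → 𝕜) (hd : ∀ k, ε ≤ ‖d k‖) (hM : ∀ z k, ‖M z k - d k * z k‖ ≤ ε / 2 * ‖z‖) :
    ∃ S : EllInftyC 𝕜 K →L[𝕜] EllInftyC 𝕜 K, ∀ z, S (M z) = z := by
  have hd0 : ∀ k, d k ≠ 0 := fun k => norm_pos_iff.1 (hε.trans_le (hd k))
  have hinv : ∀ k, ‖(d k)⁻¹‖ ≤ ε⁻¹ := fun k => by
    rw [norm_inv]
    exact inv_anti₀ hε (hd k)
  -- Dividing each row by its diagonal entry brings `M` within `1/2` of the identity.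
  let D : EllInftyC 𝕜 K →L[𝕜] EllInftyC 𝕜 K := weightedComp (fun k => (d k)⁻¹) id ⟨_, hinv⟩
    fun k => (Set.countable_singleton k).mono fun _ h => h.1
  let N : EllInftyC 𝕜 K →L[𝕜] EllInftyC 𝕜 K := ContinuousLinearMap.id 𝕜 _ - D ∘L M
  have hN : ‖N‖ ≤ 1 / 2 := by
    refine ContinuousLinearMap.opNorm_le_bound _ (by norm_num) fun z => ?_
    refine norm_le (by positivity) fun k => ?_
    have : N z k = -((d k)⁻¹ * (M z k - d k * z k)) := by
      have := hd0 k
      simp only [N, D, _root_.sub_apply, ContinuousLinearMap.comp_apply, sub_apply,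
        ContinuousLinearMap.id_apply, weightedComp_apply, id]
      field_simp
      ring
    rw [this, norm_neg, norm_mul]
    calc ‖(d k)⁻¹‖ * ‖M z k - d k * z k‖ ≤ ε⁻¹ * (ε / 2 * ‖z‖) := by
          gcongr
          exacts [hinv k, hM z k]
      _ = 1 / 2 * ‖z‖ := by field_simp
  obtain ⟨S, hS⟩ := exists_leftInverse_id_sub N (hN.trans_lt (by norm_num))
  refine ⟨S ∘L D, fun z => ?_⟩
  have : z - N z = D (M z) := by simp [N]
  simpa [this] using hS z

open Classical in
/-- The isometric embedding which sends the unit vectors to a given disjoint family. -/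
theorem exists_blockMap (A : K → Set L) (hA : Pairwise fun k l => Disjoint (A k) (A l))
    (z : K → EllInftyC 𝕜 L) (hz : ∀ k, ‖z k‖ ≤ 1) (hzA : ∀ k i, z k i ≠ 0 → i ∈ A k) :
    ∃ U : EllInftyC 𝕜 K →L[𝕜] EllInftyC 𝕜 L,
      ∀ (f : EllInftyC 𝕜 K) k, (∀ l, l ≠ k → f l = 0) → U f = f k • z k := by
  cases isEmpty_or_nonempty K with
  | inl h => exact ⟨0, fun f k => h.elim k⟩
  | inr h =>
    -- The index of the block containing `i`. The default off all blocks is harmless, since every `z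
    -- k` vanishes there.
    let j : L → K := fun i => if h : ∃ k, i ∈ A k then h.choose else Classical.arbitrary K
    have hj : ∀ k i, i ∈ A k → j i = k := fun k i hi => by
      have h : ∃ k, i ∈ A k := ⟨k, hi⟩
      have h' : j i = h.choose := dif_pos h
      by_contra hne
      exact Set.disjoint_left.1 (hA hne) (h' ▸ h.choose_spec) hi
    refine ⟨weightedComp (fun i => z (j i) i) j
      ⟨1, fun i => (norm_apply_le _ _).trans (hz _)⟩ fun k => ?_, fun f k hf => ?_⟩
    · refine (z k).countable_support.mono fun i hi => ?_
      have h1 := hi.2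
      rw [hi.1] at h1
      exact h1
    · refine ext_apply fun i => ?_
      rw [weightedComp_apply, smul_apply, mul_comm]
      by_cases hi : j i = k
      · rw [hi]
      · have : z k i = 0 := by
          by_contra h0
          exact hi (hj k i (hzA k i h0))
        rw [hf _ hi, this]
        simp

open Classical in
/-- If an operator through `X` does not vanish uniformly on a disjoint family of sets, indexed by
an infinite set `K`, then `EllInftyC 𝕜 K` is isomorphic to a complemented subspace of `X`. -/
theorem exists_factorization [Infinite K] (u : X →L[𝕜] EllInftyC 𝕜 L) (v : EllInftyC 𝕜 L →L[𝕜] X)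
    {ε : ℝ} (hε : 0 < ε) (A : K → Set L) (hA : Pairwise fun k l => Disjoint (A k) (A l))
    (h : ∀ k, ε < var (u ∘L v) (A k)) :
    ∃ (a : EllInftyC 𝕜 K →L[𝕜] X) (b : X →L[𝕜] EllInftyC 𝕜 K), ∀ z, b (a z) = z := by
  have h1 : ∀ k, ∃ z : EllInftyC 𝕜 L, ‖z‖ ≤ 1 ∧ (∀ i, z i ≠ 0 → i ∈ A k) ∧
      ∃ l, ε < ‖u (v z) l‖ := fun k => by
    obtain ⟨z, hz, hzA, hlt⟩ := exists_of_lt_var (h k)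
    refine ⟨z, hz, hzA, ?_⟩
    by_contra! hcon
    exact hlt.not_ge (norm_le hε.le hcon)
  choose z hz hzA α hα using h1
  obtain ⟨U, hU⟩ := exists_blockMap A hA z hz hzA
  let μ : K → EllInftyC 𝕜 K →L[𝕜] 𝕜 := fun k => coord 𝕜 (α k) ∘L (u ∘L v) ∘L U
  have hsingle : ∀ k l, α l = α k → ε ≤ var (μ k) {l} := fun k l hkl => by
    let f : EllInftyC 𝕜 K := mk (fun i => if i = l then 1 else 0)
      ⟨1, fun i => by by_cases hi : i = l <;> simp [hi]⟩
      ((Set.countable_singleton l).mono fun i hi => by simpa using hi)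
    have hf : ‖f‖ ≤ 1 := norm_le zero_le_one fun i => by
      by_cases hi : i = l <;> simp [f, hi]
    have hfl : ∀ i, f i ≠ 0 → i ∈ ({l} : Set K) := fun i hi => by simpa [f] using hi
    have h2 : μ k f = u (v (z l)) (α l) := by
      have : U f = f l • z l := hU f l fun i hi => by simp [f, hi]
      simp [μ, this, hkl, f]
    have h3 := norm_apply_le_var (T := μ k) hfl
    rw [h2] at h3
    nlinarith [hα l, var_nonneg (T := μ k) {l}]
  -- Each point of the fibre costs the functional `μ k` variation `ε`. Finite fibres are what lets
  -- composition with `α` preserve countable supports in `S` below.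
  have hfib : ∀ k, {l | α l = α k}.Finite := fun k => by
    by_contra hinf
    obtain ⟨n, hn⟩ := exists_nat_gt (‖μ k‖ / ε)
    obtain ⟨s, hs, hcard⟩ := Set.Infinite.exists_subset_card_eq hinf n
    have h2 : n * ε ≤ ∑ i ∈ s, var (μ k) {i} := by
      rw [← hcard, ← nsmul_eq_mul]
      exact Finset.card_nsmul_le_sum _ _ _ fun i hi => hsingle k i (hs hi)
    have h3 := (sum_var_singleton_le (μ k) s).trans (var_le_norm _)
    rw [div_lt_iff₀ hε] at hn
    linarith
  have hμ : ∀ k, ‖μ k‖ ≤ ‖(u ∘L v) ∘L U‖ := fun k =>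
    ContinuousLinearMap.opNorm_le_bound _ (norm_nonneg _) fun f =>
      (norm_apply_le _ _).trans (((u ∘L v) ∘L U).le_opNorm f)
  -- The off-diagonal part of each remaining row is at most `ε / 2`, while the diagonal exceeds `ε`.
  obtain ⟨j, hj⟩ := exists_embedding_offDiag_le (fun k => var (μ k))
    (fun k A => var_nonneg A) (fun k A => (var_le_norm A).trans (hμ k)) (half_pos hε)
    (fun k A B D hd hA hB => var_add_var_le hd hA hB)
  let S : EllInftyC 𝕜 L →L[𝕜] EllInftyC 𝕜 K :=
    weightedComp (fun _ => 1) (fun k => α (j k)) ⟨1, by simp⟩ fun l => by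
      by_cases hl : ∃ k, α (j k) = l
      · obtain ⟨k, rfl⟩ := hl
        refine ((hfib (j k)).preimage j.injective.injOn).countable.mono fun i hi => ?_
        exact hi.1
      · refine Set.countable_empty.mono fun i hi => hl ⟨i, hi.1⟩
  obtain ⟨R, hR⟩ := exists_leftInverse_of_diag (S ∘L (u ∘L v) ∘L U ∘L extend 𝕜 j) hε
    (fun k => u (v (z (j k))) (α (j k))) (fun k => (hα _).le) (fun f k => by
      have hk : (S ∘L (u ∘L v) ∘L U ∘L extend 𝕜 j) f k = μ (j k) (extend 𝕜 j f) := by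
        simp [S, μ]
      have h2 : μ (j k) (ind 𝕜 {j k} (extend 𝕜 j f)) = u (v (z (j k))) (α (j k)) * f k := by
        have : U (ind 𝕜 {j k} (extend 𝕜 j f)) = f k • z (j k) := by
          rw [hU _ (j k) fun l hl => ind_apply_of_notMem (by simpa using hl) _,
            ind_apply_of_mem (by simp), extend_apply_map]
        simp [μ, this, mul_comm]
      have h3 : extend 𝕜 j f = ind 𝕜 {j k} (extend 𝕜 j f) +
          ind 𝕜 (Set.range j \ {j k}) (extend 𝕜 j f) := by
        refine ext_apply fun l => ?_
        by_cases hl : l ∈ Set.range j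
        · by_cases hlk : l = j k <;> simp [ind, hlk]
          obtain ⟨i, rfl⟩ := hl
          exact fun h => absurd rfl (h i)
        · have hlk : l ≠ j k := fun h => hl ⟨k, h.symm⟩
          simp [extend_apply_of_notMem j f hl, ind, hlk]
      rw [hk, h3, map_add, h2, add_sub_cancel_left]
      refine (norm_apply_ind_le _ _).trans ?_
      gcongr
      exacts [hj k, norm_extend_le j f])
  exact ⟨v ∘L U ∘L extend 𝕜 j, R ∘L S ∘L u, fun f => hR f⟩

end EllInftyC

/-! ### Uniformly exhaustive submeasures. -/

section Control

variable {I L : Type*} {m : I → Set L → ℝ}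

/-- Otherwise increments above `η` start at every index, and iterating the choice makes them
disjoint. -/
theorem exists_forall_diff_le_of_exhaustive
    (hex : ∀ ε > 0, ¬ ∃ (A : ℕ → Set L) (i : ℕ → I), (Pairwise fun k l => Disjoint (A k) (A l)) ∧
      ∀ n, ε < m (i n) (A n))
    {U : ℕ → Set L} (hU : Monotone U) {η : ℝ} (hη : 0 < η) :
    ∃ b, ∀ c ≥ b, ∀ i, m i (U c \ U b) ≤ η := by
  by_contra! hcon
  choose c hc i hi using hcon
  let b : ℕ → ℕ := fun n => c^[n] 0
  have hb : ∀ n, b (n + 1) = c (b n) := fun n => Function.iterate_succ_apply' c n 0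
  have hbm : Monotone b := monotone_nat_of_le_succ fun n => by rw [hb]; exact hc _
  have hd : ∀ k l, k < l → Disjoint (U (c (b k)) \ U (b k)) (U (c (b l)) \ U (b l)) := by
    intro k l hkl
    rw [Set.disjoint_left]
    rintro x ⟨hx, -⟩ ⟨-, hx'⟩
    rw [← hb] at hx
    exact hx' (hU (hbm hkl) hx)
  refine hex η hη ⟨fun n => U (c (b n)) \ U (b n), fun n => i (b n), fun k l hkl => ?_,
    fun n => hi _⟩
  rcases hkl.lt_or_gt with h | h
  exacts [hd k l h, (hd l k h).symm]

theorem le_sum_of_subset_biUnion (h0 : ∀ i, m i ∅ ≤ 0) (hmono : ∀ i A B, A ⊆ B → m i A ≤ m i B)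
    (hunion : ∀ i A B, m i (A ∪ B) ≤ m i A + m i B) {ι : Type*} (s : Finset ι) (A : ι → Set L)
    (B : Set L) (hB : ∀ x ∈ B, ∃ n ∈ s, x ∈ A n) (i : I) :
    m i B ≤ ∑ n ∈ s, m i (A n) := by
  classical
  have h : m i (⋃ n ∈ s, A n) ≤ ∑ n ∈ s, m i (A n) := by
    clear hB
    induction s using Finset.induction_on with
    | empty => simpa using h0 i
    | insert a s ha ih =>
      rw [Finset.sum_insert ha, Finset.set_biUnion_insert]
      exact (hunion _ _ _).trans (by gcongr)
  refine (hmono i _ _ fun x hx => ?_).trans h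
  obtain ⟨n, hn, hxn⟩ := hB x hx
  exact Set.mem_biUnion (t := A) hn hxn

theorem sum_geometric_half_le {η : ℝ} (hη : 0 ≤ η) (a b : ℕ) :
    ∑ n ∈ Finset.Ico a b, η / 2 * (1 / 2) ^ n ≤ η := by
  rw [← Finset.mul_sum]
  have h1 : ∑ n ∈ Finset.Ico a b, (1 / 2 : ℝ) ^ n ≤ ∑ n ∈ Finset.range b, (1 / 2 : ℝ) ^ n :=
    Finset.sum_le_sum_of_subset_of_nonneg (fun n hn => by simp at hn ⊢; exact hn.2)
      fun _ _ _ => by positivity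
  have h2 := sum_geometric_two_le b
  nlinarith

/-- A uniformly exhaustive family of submeasures is uniformly controlled by a finite subfamily. -/
theorem exists_finite_control (h0 : ∀ i, m i ∅ ≤ 0) (hmono : ∀ i A B, A ⊆ B → m i A ≤ m i B)
    (hunion : ∀ i A B, m i (A ∪ B) ≤ m i A + m i B)
    (hex : ∀ ε > 0, ¬ ∃ (A : ℕ → Set L) (i : ℕ → I), (Pairwise fun k l => Disjoint (A k) (A l)) ∧
      ∀ n, ε < m (i n) (A n)) {ε : ℝ} (hε : 0 < ε) :
    ∃ F : Finset I, ∃ δ > 0, ∀ A, (∀ i ∈ F, m i A < δ) → ∀ i, m i A ≤ ε := by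
  classical
  by_contra! hcon
  -- Two errors `η` arise in passing from `D b` to `D (b + 1)`, a third from the size of `D (b +
  -- 1)`.
  obtain ⟨η, hη, hηε⟩ : ∃ η : ℝ, 0 < η ∧ 3 * η ≤ ε := ⟨ε / 3, by positivity, by linarith⟩
  have hρ : ∀ n : ℕ, 0 < η / 2 * (1 / 2 : ℝ) ^ n := fun n => by positivity
  -- Each new set is large for its own submeasure but negligible for all earlier ones; the
  -- increasing natural label sets the geometric rate.
  obtain ⟨f, hfP, hfr⟩ := exists_seq_of_forall_finset_exists
    (fun x : ℕ × I × Set L => ε < m x.2.1 x.2.2)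
    (fun x y => x.1 < y.1 ∧ m x.2.1 y.2.2 < η / 2 * (1 / 2) ^ y.1) (fun s _ => by
      obtain ⟨A, hA, i, hi⟩ := hcon (s.image fun x => x.2.1) _ (hρ (s.sup (fun x => x.1) + 1))
      exact ⟨(_, i, A), hi, fun x hx => ⟨Nat.lt_succ_of_le (Finset.le_sup (f := fun x => x.1) hx),
        hA _ (Finset.mem_image_of_mem _ hx)⟩⟩)
  let A : ℕ → Set L := fun n => (f n).2.2
  let i : ℕ → I := fun n => (f n).2.1
  have hk : ∀ n, n ≤ (f n).1 := fun n => StrictMono.le_apply (f := fun n => (f n).1)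
    (strictMono_nat_of_lt_succ fun n => (hfr n (n + 1) n.lt_succ_self).1)
  have hA : ∀ n, ε < m (i n) (A n) := hfP
  have hsmall : ∀ j n, j < n → m (i j) (A n) ≤ η / 2 * (1 / 2) ^ n := fun j n hjn =>
    (hfr j n hjn).2.le.trans (by
      gcongr ?_ * ?_
      exact pow_le_pow_of_le_one (by norm_num) (by norm_num) (hk n))
  let U : ℕ → ℕ → Set L := fun a b => {x | ∃ n, a ≤ n ∧ n < b ∧ x ∈ A n}
  have hUm : ∀ a, Monotone (U a) := fun a b c hbc x ⟨n, h1, h2, h3⟩ => ⟨n, h1, h2.trans_le hbc, h3⟩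
  -- Finitely many sets from `a` on nearly exhaust every longer union, uniformly in `i`.
  have hstep : ∀ k a : ℕ, ∃ b > a, ∀ c ≥ b, ∀ i, m i (U a c \ U a b) ≤ η / 2 * (1 / 2) ^ k := by
    intro k a
    obtain ⟨b, hb⟩ := exists_forall_diff_le_of_exhaustive hex
      (U := fun n => U a (a + 1 + n)) (fun n n' h => hUm a (by omega)) (hρ k)
    refine ⟨a + 1 + b, by omega, fun c hc => ?_⟩
    obtain ⟨d, rfl⟩ : ∃ d, c = a + 1 + d := ⟨c - (a + 1), by omega⟩
    exact hb d (by omega)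
  choose g hg hgU using hstep
  let a : ℕ → ℕ := fun n => Nat.rec 0 (fun k r => g k r) n
  have ha : ∀ k, a (k + 1) = g k (a k) := fun k => rfl
  have halt : ∀ k, a k < a (k + 1) := fun k => hg k (a k)
  have ham : Monotone a := monotone_nat_of_le_succ fun k => (halt k).le
  let D : ℕ → Set L := fun k => U (a k) (a (k + 1))
  -- A point of `D k` outside `D j`, for `j < k`, lies in the small remainder left by stage `j`.
  -- Hence the decreasing sets `E k` nearly fill the `D k`, and exhaustivity makes them stall at
  -- some `b`.
  let E : ℕ → Set L := fun k => {x | ∀ j ≤ k, x ∈ D j}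
  have hDE : ∀ k i, m i (D k \ E k) ≤ η := fun k i => by
    refine (le_sum_of_subset_biUnion h0 hmono hunion (Finset.Ico 0 k)
      (fun j => U (a j) (a (k + 1)) \ U (a j) (a (j + 1))) _ (fun x hx => ?_) i).trans
      ((Finset.sum_le_sum fun j hj => ?_).trans (sum_geometric_half_le hη.le 0 k))
    · obtain ⟨⟨n, h1, h2, h3⟩, hxE⟩ := hx
      simp only [E, Set.mem_ofPred_eq, not_forall] at hxE
      obtain ⟨j, hj, hxj⟩ := hxE
      have hjk : j < k := lt_of_le_of_ne hj fun h => hxj (h ▸ ⟨n, h1, h2, h3⟩)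
      exact ⟨j, by simpa using hjk, ⟨n, (ham hj).trans h1, h2, h3⟩, hxj⟩
    · have hjk : j < k := by simpa using hj
      exact hgU j (a j) _ (ham (Nat.succ_le_succ hjk.le)) i
  obtain ⟨b, hb⟩ := exists_forall_diff_le_of_exhaustive hex (U := fun n => (E n)ᶜ)
    (fun k l hkl => Set.compl_subset_compl.2 fun x hx j hj => hx j (hj.trans hkl)) hη
  have hcalc : ∀ i, m i (D b) ≤ m i (D (b + 1)) + 2 * η := fun i => by
    have h1 : m i (D b) ≤ m i (E b) + m i (D b \ E b) :=
      (hmono i _ _ (by rw [Set.union_sdiff_self]; exact Set.subset_union_right)).trans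
        (hunion i (E b) (D b \ E b))
    have h2 : m i (E b) ≤ m i (E (b + 1)) + m i ((E (b + 1))ᶜ \ (E b)ᶜ) :=
      (hmono i _ _ fun x hx => by
        by_cases h : x ∈ E (b + 1)
        exacts [Or.inl h, Or.inr ⟨h, fun h' => h' hx⟩]).trans (hunion i _ _)
    have h3 : m i (E (b + 1)) ≤ m i (D (b + 1)) := hmono i _ _ fun x hx => hx _ le_rfl
    linarith [hDE b i, hb (b + 1) (by omega) i]
  -- The contradiction: the submeasure of index `a b` is large on `D b` but small on `D (b + 1)`,
  -- all of whose sets come later.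
  have h1 : m (i (a b)) (A (a b)) ≤ m (i (a b)) (D b) :=
    hmono _ _ _ fun x hx => ⟨a b, le_rfl, halt b, hx⟩
  have h2 : m (i (a b)) (D (b + 1)) ≤ η := by
    refine (le_sum_of_subset_biUnion h0 hmono hunion (Finset.Ico (a (b + 1)) (a (b + 2))) A _
      (fun x hx => ?_) _).trans ((Finset.sum_le_sum fun n hn => hsmall _ _ ?_).trans
        (sum_geometric_half_le hη.le _ _))
    · obtain ⟨n, h1, h2, h3⟩ := hx
      exact ⟨n, Finset.mem_Ico.2 ⟨h1, h2⟩, h3⟩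
    · exact (halt b).trans_le (Finset.mem_Ico.1 hn).1
  linarith [hA (a b), hcalc (i (a b))]

end Control

/-! ### Hilbertian forms and finite-dimensionality. -/

/-- For linear functionals dominated by a positive definite form, Bessel's inequality holds. -/
theorem sum_sq_le_of_orthonormal {V ι : Type*} [AddCommGroup V] [Module ℝ V] [Fintype ι]
    (B : LinearMap.BilinForm ℝ V) (w : ι → V) (h1 : ∀ i, B (w i) (w i) = 1)
    (h2 : ∀ i j, i ≠ j → B (w i) (w j) = 0) (l : V →ₗ[ℝ] ℝ) {C : ℝ}
    (hC : 0 ≤ C) (hl : ∀ x, l x ^ 2 ≤ C * B x x) : ∑ i, l (w i) ^ 2 ≤ C := by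
  classical
  -- At this vector `l x` and `B x x` both equal the sum to be bounded.
  let x := ∑ i, l (w i) • w i
  have hx : B x x = ∑ i, l (w i) ^ 2 := by
    simp only [x, map_sum, LinearMap.sum_apply, map_smul, LinearMap.smul_apply, smul_eq_mul]
    refine Finset.sum_congr rfl fun i _ => ?_
    rw [Finset.sum_eq_single i]
    · rw [h1]; ring
    · intro j _ hj
      rw [h2 _ _ hj]
      ring
    · simp
  have hlx : l x = ∑ i, l (w i) ^ 2 := by
    simp [x, map_sum, sq]
  have h := hl x
  rw [hx, hlx] at h
  have h0 : 0 ≤ ∑ i, l (w i) ^ 2 := Finset.sum_nonneg fun _ _ => sq_nonneg _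
  rcases h0.eq_or_lt with h' | h'
  · rwa [← h']
  · nlinarith

namespace EllInftyC

variable {𝕜 : Type*} [RCLike 𝕜] {L : Type*}

/-- Multiplication by a bounded real function. -/
noncomputable def scal (h : L → ℝ) (hb : ∃ C, ∀ i, |h i| ≤ C) :
    EllInftyC 𝕜 L →L[𝕜] EllInftyC 𝕜 L :=
  weightedComp (fun i => (h i : 𝕜)) id (hb.imp fun C hC i => by simpa using hC i)
    fun k => (Set.countable_singleton k).mono fun _ h => h.1

theorem scal_apply (h : L → ℝ) (hb) (g : EllInftyC 𝕜 L) (i : L) : scal h hb g i = h i * g i := rfl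

theorem norm_scal_apply_le {h : L → ℝ} {hb} {K : ℝ} (hK : 0 ≤ K) (h1 : ∀ i, |h i| ≤ K)
    {g : EllInftyC 𝕜 L} (hg : ‖g‖ ≤ 1) : ‖scal h hb g‖ ≤ K :=
  (norm_weightedComp_apply_le g hK fun i => by simpa using h1 i).trans
    (mul_le_of_le_one_right hK hg)

theorem exists_almost_norming (μ : EllInftyC 𝕜 L →L[𝕜] 𝕜) {η : ℝ} (hη : 0 < η) :
    ∃ g : EllInftyC 𝕜 L, ‖g‖ ≤ 1 ∧ ‖μ‖ - η ≤ RCLike.re (μ g) := by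
  obtain ⟨x, hx, hlt⟩ := ContinuousLinearMap.exists_lt_apply_of_lt_opNorm μ (sub_lt_self _ hη)
  obtain ⟨c, hc, hcx⟩ := exists_phase (μ x)
  refine ⟨c • x, ?_, ?_⟩
  · rw [norm_smul]
    exact mul_le_one₀ hc (norm_nonneg _) hx.le
  · rw [map_smul, smul_eq_mul, hcx, RCLike.ofReal_re]
    exact hlt.le

theorem re_apply_le (μ : EllInftyC 𝕜 L →L[𝕜] 𝕜) (x : EllInftyC 𝕜 L) :
    RCLike.re (μ x) ≤ ‖μ‖ * ‖x‖ :=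
  (RCLike.re_le_norm _).trans (μ.le_opNorm x)

section AlmostNorming

variable {μ : EllInftyC 𝕜 L →L[𝕜] 𝕜} {η : ℝ} {g : EllInftyC 𝕜 L}

/-- If `g` almost norms `μ`, then `h ↦ Re μ(h g)` is almost positive. -/
theorem neg_le_re_apply_scal (hg : ‖g‖ ≤ 1) (hμ : ‖μ‖ - η ≤ RCLike.re (μ g)) {h : L → ℝ} {hb}
    {K : ℝ} (hK : 0 ≤ K) (h0 : ∀ i, 0 ≤ h i) (h1 : ∀ i, h i ≤ K) :
    -(η * K) ≤ RCLike.re (μ (scal h hb g)) := by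
  have hb' : ∀ i, |K - h i| ≤ K := fun i => abs_le.2 ⟨by linarith [h1 i], by linarith [h0 i]⟩
  -- `K • g` almost attains `K * ‖μ‖`, and the subtracted term cannot exceed that value.
  have h2 : scal h hb g = (K : 𝕜) • g - scal (fun i => K - h i) ⟨K, hb'⟩ g :=
    ext_apply fun i => by
      rw [sub_apply, smul_apply, scal_apply, scal_apply]
      push_cast
      ring
  have h3 := re_apply_le μ (scal (fun i => K - h i) ⟨K, hb'⟩ g)
  have h4 := mul_le_mul_of_nonneg_left (norm_scal_apply_le (hb := ⟨K, hb'⟩) hK hb' hg)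
    (norm_nonneg μ)
  rw [h2, map_sub, map_smul, smul_eq_mul, map_sub, RCLike.re_ofReal_mul]
  nlinarith

/-- By superadditivity the complement contributes at most `‖μ‖ - var μ A`, so the rest of the almost
attained norm comes from `A`. -/
theorem var_sub_le_re_apply_ind (hg : ‖g‖ ≤ 1) (hμ : ‖μ‖ - η ≤ RCLike.re (μ g)) (A : Set L) :
    var μ A - η ≤ RCLike.re (μ (ind 𝕜 A g)) := by
  have h1 : RCLike.re (μ g) = RCLike.re (μ (ind 𝕜 A g)) + RCLike.re (μ (ind 𝕜 Aᶜ g)) := by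
    rw [← map_add, ← map_add, ind_add_ind_compl]
  have h2 : var μ A + var μ Aᶜ ≤ ‖μ‖ :=
    (var_add_var_le disjoint_compl_right (Set.subset_univ _) (Set.subset_univ _)).trans
      (var_le_norm _)
  have h3 : RCLike.re (μ (ind 𝕜 Aᶜ g)) ≤ var μ Aᶜ :=
    (RCLike.re_le_norm _).trans ((norm_apply_ind_le _ _).trans
      (mul_le_of_le_one_right (var_nonneg _) hg))
  linarith

-- A Chebyshev inequality: subtracting `s` on `A` leaves a multiplier between `0` and `K`, on which
-- the functional is almost nonnegative.
open Classical in
theorem le_re_apply_scal (hg : ‖g‖ ≤ 1) (hμ : ‖μ‖ - η ≤ RCLike.re (μ g)) {h : L → ℝ} {hb}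
    {K s : ℝ} (hs : 0 ≤ s) (hK : 0 ≤ K) (h0 : ∀ i, 0 ≤ h i) (h1 : ∀ i, h i ≤ K) {A : Set L}
    (hA : ∀ i ∈ A, s ≤ h i) :
    s * (var μ A - η) - η * K ≤ RCLike.re (μ (scal h hb g)) := by
  let h' : L → ℝ := fun i => if i ∈ A then h i - s else h i
  have h0' : ∀ i, 0 ≤ h' i := fun i => by
    by_cases hi : i ∈ A
    · simpa [h', hi] using hA i hi
    · simpa [h', hi] using h0 i
  have h1' : ∀ i, h' i ≤ K := fun i => by
    by_cases hi : i ∈ A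
    · simp only [h', hi, if_true]
      linarith [h1 i]
    · simpa [h', hi] using h1 i
  have hb' : ∃ C, ∀ i, |h' i| ≤ C := ⟨K, fun i => by rw [abs_of_nonneg (h0' i)]; exact h1' i⟩
  have h2 : scal h hb g = (s : 𝕜) • ind 𝕜 A g + scal h' hb' g := ext_apply fun i => by
    rw [add_apply, smul_apply, scal_apply, scal_apply]
    by_cases hi : i ∈ A
    · rw [ind_apply_of_mem hi]
      simp [h', hi]
      ring
    · rw [ind_apply_of_notMem hi]
      simp [h', hi]
  have h3 := neg_le_re_apply_scal hg hμ (hb := hb') hK h0' h1'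
  have h4 := mul_le_mul_of_nonneg_left (var_sub_le_re_apply_ind hg hμ A) hs
  rw [h2, map_add, map_smul, smul_eq_mul, map_add, RCLike.re_ofReal_mul]
  linarith

end AlmostNorming

/-- The real part of the pointwise inner product is bounded. -/
theorem abs_re_mul_conj_le (x y : EllInftyC 𝕜 L) (i : L) :
    |RCLike.re (x i * (starRingEnd 𝕜) (y i))| ≤ ‖x‖ * ‖y‖ := by
  refine (RCLike.abs_re_le_norm _).trans ?_
  rw [norm_mul, RCLike.norm_conj]
  gcongr
  exacts [norm_apply_le x i, norm_apply_le y i]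

/-- The product of `g` with the real part of the pointwise inner product. -/
noncomputable def innerMul (g x y : EllInftyC 𝕜 L) : EllInftyC 𝕜 L :=
  scal (fun i => RCLike.re (x i * (starRingEnd 𝕜) (y i))) ⟨_, abs_re_mul_conj_le x y⟩ g

theorem innerMul_apply (g x y : EllInftyC 𝕜 L) (i : L) :
    innerMul g x y i = (RCLike.re (x i * (starRingEnd 𝕜) (y i)) : 𝕜) * g i := rfl

theorem innerMul_comm (g x y : EllInftyC 𝕜 L) : innerMul g x y = innerMul g y x :=
  ext_apply fun i => by
    rw [innerMul_apply, innerMul_apply, ← RCLike.conj_re (x i * _), map_mul, RCLike.conj_conj,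
      mul_comm (y i)]

theorem innerMul_add (g x x' y : EllInftyC 𝕜 L) :
    innerMul g (x + x') y = innerMul g x y + innerMul g x' y :=
  ext_apply fun i => by
    simp only [innerMul_apply, add_apply, add_mul, map_add]

theorem innerMul_smul (g x y : EllInftyC 𝕜 L) (r : ℝ) :
    innerMul g ((r : 𝕜) • x) y = (r : 𝕜) • innerMul g x y :=
  ext_apply fun i => by
    simp only [innerMul_apply, smul_apply, mul_assoc, RCLike.re_ofReal_mul, RCLike.ofReal_mul]

variable {X : Type*} [NormedAddCommGroup X] [NormedSpace 𝕜 X]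

/-- The real bilinear form on `X` given by an embedding `u` into `EllInftyC 𝕜 L`, finitely many
functionals and multipliers. -/
noncomputable def innerForm [Module ℝ X] [IsScalarTower ℝ 𝕜 X] {I : Type*} (F : Finset I)
    (μ : I → EllInftyC 𝕜 L →L[𝕜] 𝕜) (g : I → EllInftyC 𝕜 L) (u : X →L[𝕜] EllInftyC 𝕜 L) :
    LinearMap.BilinForm ℝ X :=
  have hadd : ∀ x x' y, ∑ i ∈ F, RCLike.re (μ i (innerMul (g i) (u (x + x')) (u y))) =
      ∑ i ∈ F, RCLike.re (μ i (innerMul (g i) (u x) (u y))) +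
        ∑ i ∈ F, RCLike.re (μ i (innerMul (g i) (u x') (u y))) := fun x x' y => by
    simp only [map_add, innerMul_add, Finset.sum_add_distrib]
  have hsmul : ∀ (r : ℝ) x y, ∑ i ∈ F, RCLike.re (μ i (innerMul (g i) (u (r • x)) (u y))) =
      r • ∑ i ∈ F, RCLike.re (μ i (innerMul (g i) (u x) (u y))) := fun r x y => by
    simp only [RCLike.real_smul_eq_coe_smul (K := 𝕜) r x, map_smul, innerMul_smul, smul_eq_mul,
      RCLike.re_ofReal_mul, Finset.mul_sum]
  LinearMap.mk₂ ℝ (fun x y => ∑ i ∈ F, RCLike.re (μ i (innerMul (g i) (u x) (u y))))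
    hadd hsmul
    (fun x y y' => by simpa only [innerMul_comm _ (u x)] using hadd y y' x)
    (fun r x y => by simpa only [innerMul_comm _ (u x)] using hsmul r y x)

theorem innerForm_apply [Module ℝ X] [IsScalarTower ℝ 𝕜 X] {I : Type*} (F : Finset I)
    (μ : I → EllInftyC 𝕜 L →L[𝕜] 𝕜) (g : I → EllInftyC 𝕜 L) (u : X →L[𝕜] EllInftyC 𝕜 L) (x y : X) :
    innerForm F μ g u x y = ∑ i ∈ F, RCLike.re (μ i (innerMul (g i) (u x) (u y))) := rfl

/-- If the supremum norm of `EllInftyC 𝕜 L` is dominated on the image of `X` by a form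
`innerForm`, then `X` is finite-dimensional. -/
theorem card_le_of_orthonormal [Module ℝ X] [IsScalarTower ℝ 𝕜 X] {I ι : Type*} [Fintype ι]
    (F : Finset I) (μ : I → EllInftyC 𝕜 L →L[𝕜] 𝕜) (g : I → EllInftyC 𝕜 L) (hg : ∀ i, ‖g i‖ ≤ 1)
    (u : X →L[𝕜] EllInftyC 𝕜 L) {C : ℝ} (hC : 0 ≤ C)
    (hu : ∀ x, ‖u x‖ ^ 2 ≤ C * innerForm F μ g u x x)
    (w : ι → X) (h1 : ∀ i, innerForm F μ g u (w i) (w i) = 1)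
    (h2 : ∀ i j, i ≠ j → innerForm F μ g u (w i) (w j) = 0) :
    (Fintype.card ι : ℝ) ≤ (∑ i ∈ F, ‖μ i‖) * (2 * C) := by
  -- Bessel for the real and the imaginary part of evaluation at `k`, hence the factor 2. The bound
  -- does not depend on the number of vectors; applying the functionals to it bounds that number.
  have hbes : ∀ k, ∑ j, RCLike.re (u (w j) k * (starRingEnd 𝕜) (u (w j) k)) ≤ 2 * C := fun k => by
    let lre : X →ₗ[ℝ] ℝ :=
      { toFun := fun x => RCLike.re (u x k)
        map_add' := fun x y => by simp
        map_smul' := fun r x => by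
          rw [RCLike.real_smul_eq_coe_smul (K := 𝕜) r x, map_smul, smul_apply,
            RCLike.re_ofReal_mul]
          rfl }
    let lim : X →ₗ[ℝ] ℝ :=
      { toFun := fun x => RCLike.im (u x k)
        map_add' := fun x y => by simp
        map_smul' := fun r x => by
          rw [RCLike.real_smul_eq_coe_smul (K := 𝕜) r x, map_smul, smul_apply,
            RCLike.im_ofReal_mul]
          rfl }
    have hre := sum_sq_le_of_orthonormal _ w h1 h2 lre hC fun x => (hu x).trans' <|
      sq_le_sq.2 <| by
        rw [abs_norm]
        exact (RCLike.abs_re_le_norm _).trans (norm_apply_le _ _)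
    have him := sum_sq_le_of_orthonormal _ w h1 h2 lim hC fun x => (hu x).trans' <|
      sq_le_sq.2 <| by
        rw [abs_norm]
        exact (RCLike.abs_im_le_norm _).trans (norm_apply_le _ _)
    have heq : ∀ j, RCLike.re (u (w j) k * (starRingEnd 𝕜) (u (w j) k)) =
        lre (w j) ^ 2 + lim (w j) ^ 2 := fun j => by
      simp [lre, lim, RCLike.mul_re, sq]
    simp only [heq, Finset.sum_add_distrib]
    linarith
  have hnn : ∀ j k, 0 ≤ RCLike.re (u (w j) k * (starRingEnd 𝕜) (u (w j) k)) := fun j k => by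
    rw [RCLike.mul_conj, ← RCLike.ofReal_pow, RCLike.ofReal_re]
    positivity
  have habs : ∀ k, |∑ j, RCLike.re (u (w j) k * (starRingEnd 𝕜) (u (w j) k))| ≤ 2 * C := fun k => by
    rw [abs_of_nonneg (Finset.sum_nonneg fun j _ => hnn j k)]
    exact hbes k
  have hsum : ∀ i, ∑ j, μ i (innerMul (g i) (u (w j)) (u (w j))) =
      μ i (scal (fun k => ∑ j, RCLike.re (u (w j) k * (starRingEnd 𝕜) (u (w j) k))) ⟨_, habs⟩
        (g i)) := fun i => by
    rw [← map_sum]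
    congr 1
    refine ext_apply fun k => ?_
    change coord 𝕜 k (∑ j, _) = _
    rw [map_sum, scal_apply, RCLike.ofReal_sum, Finset.sum_mul]
    rfl
  calc (Fintype.card ι : ℝ) = ∑ j : ι, innerForm F μ g u (w j) (w j) := by simp [h1]
    _ = ∑ i ∈ F, RCLike.re (∑ j, μ i (innerMul (g i) (u (w j)) (u (w j)))) := by
      simp only [innerForm_apply, map_sum]
      exact Finset.sum_comm
    _ ≤ ∑ i ∈ F, ‖μ i‖ * (2 * C) := by
      refine Finset.sum_le_sum fun i _ => ?_
      rw [hsum]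
      refine (re_apply_le _ _).trans ?_
      gcongr
      exact norm_scal_apply_le (by positivity) habs (hg i)
    _ = (∑ i ∈ F, ‖μ i‖) * (2 * C) := (Finset.sum_mul ..).symm

/-- A positive definite form whose orthonormal families have bounded size lives on a
finite-dimensional space. -/
theorem finiteDimensional_of_card_orthonormal_le {V : Type*} [AddCommGroup V] [Module ℝ V]
    (B : LinearMap.BilinForm ℝ V) (hsymm : ∀ x y, B x y = B y x) (hpos : ∀ x, x ≠ 0 → 0 < B x x)
    {M : ℝ} (h : ∀ (n : ℕ) (w : Fin n → V), (∀ i, B (w i) (w i) = 1) →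
      (∀ i j, i ≠ j → B (w i) (w j) = 0) → (n : ℝ) ≤ M) : FiniteDimensional ℝ V := by
  have hrank : Module.rank ℝ V ≤ (⌊M⌋₊ : ℕ) := by
    refine rank_le fun s hs => ?_
    let W := Submodule.span ℝ (s : Set V)
    have hW : Module.finrank ℝ W = s.card := finrank_span_finset_eq_card hs
    let BW : LinearMap.BilinForm ℝ W := B.restrict W
    -- Normalizing an orthogonal basis of the span gives as many orthonormal vectors as there were
    -- independent ones.
    obtain ⟨v, hv⟩ := LinearMap.BilinForm.exists_orthogonal_basis (B := BW)
      ⟨fun x y => hsymm x y⟩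
    have hvpos : ∀ i, 0 < B (v i) (v i) := fun i => hpos _ fun h0 => v.ne_zero i (Subtype.ext h0)
    have hle := h _ (fun i => (√(B (v i) (v i)))⁻¹ • (v i : V))
      (fun i => by
        have h1 := Real.mul_self_sqrt (hvpos i).le
        have h2 := Real.sqrt_pos.2 (hvpos i)
        simp only [map_smul, LinearMap.smul_apply, smul_eq_mul]
        field_simp
        linarith)
      (fun i j hij => by
        have : B (v i) (v j) = 0 := hv hij
        simp [this])
    rw [← hW]
    exact Nat.le_floor hle
  exact Module.rank_lt_aleph0_iff.1 (hrank.trans_lt (Cardinal.natCast_lt_aleph0))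

/-- A complemented subspace of `EllInftyC 𝕜 L` is finite-dimensional if the projection onto it is
small on all but finitely many members of each disjoint sequence of sets. -/
theorem finiteDimensional_of_exhaustive (u : X →L[𝕜] EllInftyC 𝕜 L) (v : EllInftyC 𝕜 L →L[𝕜] X)
    (h : ∀ x, v (u x) = x)
    (hex : ∀ ε > 0, ¬ ∃ A : ℕ → Set L, (Pairwise fun k l => Disjoint (A k) (A l)) ∧
      ∀ n, ε < var (u ∘L v) (A n)) : FiniteDimensional 𝕜 X := by
  let P := u ∘L v
  let μ : L → EllInftyC 𝕜 L →L[𝕜] 𝕜 := fun i => coord 𝕜 i ∘L P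
  have hμP : ∀ i A, var (μ i) A ≤ var P A := fun i A => var_le (var_nonneg A) fun z =>
    (norm_apply_le _ _).trans (norm_apply_ind_le A z)
  obtain ⟨F, δ, hδ, hF⟩ := exists_finite_control (m := fun i => var (μ i))
    (fun i => var_le le_rfl fun z => by
      have : ind 𝕜 ∅ z = 0 := ext_apply fun i => by simp [ind]
      simp [this])
    (fun i A B hAB => var_mono hAB) (fun i A B => var_union_le A B)
    (fun ε hε ⟨A, i, hA, hi⟩ => hex ε hε ⟨A, hA, fun n => (hi n).trans_le (hμP _ _)⟩)
    (ε := 1 / 4) (by norm_num)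
  obtain ⟨t, ht, ht1, htP⟩ : ∃ t : ℝ, 0 < t ∧ t ≤ 1 ∧ ‖P‖ * t ≤ 1 / 4 := by
    refine ⟨1 / (4 * (‖P‖ + 1)), by positivity, ?_, ?_⟩
    · rw [div_le_one (by positivity)]
      linarith [norm_nonneg P]
    · rw [mul_one_div, div_le_div_iff₀ (by positivity) (by norm_num)]
      linarith
  -- The norming errors of all functionals in `F` together may cost at most half of `t ^ 2 * δ`.
  obtain ⟨η, hη, hηF⟩ : ∃ η : ℝ, 0 < η ∧ (F.card + 1) * η ≤ t ^ 2 * δ / 2 := by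
    refine ⟨t ^ 2 * δ / 2 / (F.card + 1), by positivity, le_of_eq ?_⟩
    field_simp
  choose g hg hgμ using fun i => exists_almost_norming (μ i) hη
  let _ : Module ℝ X := Module.compHom X (algebraMap ℝ 𝕜)
  have : IsScalarTower ℝ 𝕜 X := IsScalarTower.of_algebraMap_smul fun r x => rfl
  let B := innerForm F μ g u
  have hlow : ∀ x, t ^ 2 * δ / 2 * ‖u x‖ ^ 2 ≤ B x x := fun x => by
    by_cases hux : u x = 0
    · have : B x x = 0 := Finset.sum_eq_zero fun i _ => by
        have : innerMul (g i) (u x) (u x) = 0 := ext_apply fun k => by simp [innerMul_apply, hux]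
        simp [this]
      simp [this, hux]
    have hr : 0 < ‖u x‖ := norm_pos_iff.2 hux
    -- If all controlling functionals were small on `A`, then in `u x = P (u x)` the parts on and
    -- off `A` would contribute at most `1/4` of the norm each.
    let A : Set L := {k | t * ‖u x‖ < ‖u x k‖}
    have hnot : ¬ ∀ i ∈ F, var (μ i) A < δ := by
      intro hA
      have hsmall := hF A hA
      have : ‖u x‖ ≤ 1 / 2 * ‖u x‖ := norm_le (by positivity) fun k => by
        have h1 : u x k = μ k (ind 𝕜 A (u x)) + μ k (ind 𝕜 Aᶜ (u x)) := by
          rw [← map_add, ind_add_ind_compl]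
          simp [μ, P, h]
        have h2 : ‖μ k (ind 𝕜 A (u x))‖ ≤ 1 / 4 * ‖u x‖ :=
          (norm_apply_ind_le _ _).trans (by gcongr; exact hsmall k)
        have h3 : ‖ind 𝕜 Aᶜ (u x)‖ ≤ t * ‖u x‖ := norm_le (by positivity) fun l => by
          by_cases hl : l ∈ A
          · rw [ind_apply_of_notMem (by simpa using hl), norm_zero]
            positivity
          · rw [ind_apply_of_mem (by simpa using hl)]
            exact not_lt.1 hl
        have h4 : ‖μ k (ind 𝕜 Aᶜ (u x))‖ ≤ 1 / 4 * ‖u x‖ :=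
          calc ‖μ k (ind 𝕜 Aᶜ (u x))‖ ≤ ‖P (ind 𝕜 Aᶜ (u x))‖ := norm_apply_le _ _
            _ ≤ ‖P‖ * ‖ind 𝕜 Aᶜ (u x)‖ := P.le_opNorm _
            _ ≤ ‖P‖ * (t * ‖u x‖) := by gcongr
            _ = ‖P‖ * t * ‖u x‖ := by ring
            _ ≤ 1 / 4 * ‖u x‖ := by gcongr
        rw [h1]
        refine (norm_add_le _ _).trans ?_
        linarith
      linarith
    push Not at hnot
    obtain ⟨i₀, hi₀, hvar⟩ := hnot
    have hsq : ∀ k, RCLike.re (u x k * (starRingEnd 𝕜) (u x k)) = ‖u x k‖ ^ 2 := fun k => by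
      rw [RCLike.mul_conj, ← RCLike.ofReal_pow, RCLike.ofReal_re]
    have h0 : ∀ k, 0 ≤ RCLike.re (u x k * (starRingEnd 𝕜) (u x k)) := fun k => by
      rw [hsq]; positivity
    have h1 : ∀ k, RCLike.re (u x k * (starRingEnd 𝕜) (u x k)) ≤ ‖u x‖ ^ 2 := fun k => by
      rw [hsq]
      gcongr
      exact norm_apply_le _ _
    have hterm : ∀ i, -(η * ‖u x‖ ^ 2) ≤ RCLike.re (μ i (innerMul (g i) (u x) (u x))) := fun i =>
      neg_le_re_apply_scal (hg i) (hgμ i) (by positivity) h0 h1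
    have hterm₀ : (t * ‖u x‖) ^ 2 * (δ - η) - η * ‖u x‖ ^ 2 ≤
        RCLike.re (μ i₀ (innerMul (g i₀) (u x) (u x))) := by
      refine le_trans ?_ (le_re_apply_scal (hg i₀) (hgμ i₀) (s := (t * ‖u x‖) ^ 2) (A := A)
        (by positivity) (by positivity) h0 h1 fun k hk => ?_)
      · gcongr
      · rw [hsq]
        exact pow_le_pow_left₀ (by positivity) (le_of_lt hk) 2
    have hsum : (t * ‖u x‖) ^ 2 * (δ - η) - F.card * (η * ‖u x‖ ^ 2) ≤ B x x := by
      classical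
      have h5 : B x x = RCLike.re (μ i₀ (innerMul (g i₀) (u x) (u x))) +
          ∑ i ∈ F.erase i₀, RCLike.re (μ i (innerMul (g i) (u x) (u x))) :=
        (Finset.add_sum_erase F _ hi₀).symm
      have h6 := Finset.card_nsmul_le_sum (F.erase i₀) _ _ fun i _ => hterm i
      have h7 : ((F.erase i₀).card : ℝ) = F.card - 1 := by
        rw [Finset.card_erase_of_mem hi₀, Nat.cast_sub (Finset.card_pos.2 ⟨_, hi₀⟩), Nat.cast_one]
      rw [nsmul_eq_mul, h7] at h6
      rw [h5]
      linarith
    have h8 : t ^ 2 * η ≤ η := mul_le_of_le_one_left hη.le (pow_le_one₀ ht.le ht1)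
    have h9 : t ^ 2 * δ / 2 ≤ t ^ 2 * (δ - η) - F.card * η := by linarith
    calc t ^ 2 * δ / 2 * ‖u x‖ ^ 2 ≤ (t ^ 2 * (δ - η) - F.card * η) * ‖u x‖ ^ 2 := by gcongr
      _ = (t * ‖u x‖) ^ 2 * (δ - η) - F.card * (η * ‖u x‖ ^ 2) := by ring
      _ ≤ B x x := hsum
  have hc : 0 < t ^ 2 * δ / 2 := by positivity
  have hfin : FiniteDimensional ℝ X := finiteDimensional_of_card_orthonormal_le B
    (fun x y => by simp only [B, innerForm_apply, innerMul_comm _ (u x)])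
    (fun x hx => by
      have hux : u x ≠ 0 := fun h0 => hx (by rw [← h x, h0, map_zero])
      have : 0 < ‖u x‖ := norm_pos_iff.2 hux
      exact lt_of_lt_of_le (by positivity) (hlow x))
    (fun n w hw1 hw2 => by
      have := card_le_of_orthonormal F μ g hg u (C := (t ^ 2 * δ / 2)⁻¹) (by positivity)
        (fun x => by
          rw [inv_mul_eq_div, le_div_iff₀ hc, mul_comm]
          exact hlow x) w hw1 hw2
      rwa [Fintype.card_fin] at this)
  exact Module.Finite.of_restrictScalars_finite ℝ 𝕜 X

end EllInftyC

/-! ### Classification and primariness. -/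

namespace EllInftyC

variable {𝕜 : Type*} [RCLike 𝕜]

theorem extend_restr_subtype {L : Type*} (Γ : Set L) (z : EllInftyC 𝕜 L) :
    extend 𝕜 (Function.Embedding.subtype (· ∈ Γ)) (restr 𝕜 (Function.Embedding.subtype (· ∈ Γ)) z) =
      ind 𝕜 Γ z := by
  refine ext_apply fun i => ?_
  by_cases hi : i ∈ Γ
  · rw [ind_apply_of_mem hi]
    exact (extend_apply_map (Function.Embedding.subtype (· ∈ Γ)) _ ⟨i, hi⟩).trans
      (restr_apply _ _ _)
  · rw [ind_apply_of_notMem hi, extend_apply_of_notMem]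
    rintro ⟨⟨j, hj⟩, rfl⟩
    exact hi hj

variable {X : Type*} [NormedAddCommGroup X] [NormedSpace 𝕜 X]

/-- Up to a small perturbation, an operator is carried by the union of a disjoint family of
countable sets on which it is large. -/
theorem exists_disjoint_countable_family {L : Type*} (P : EllInftyC 𝕜 L →L[𝕜] EllInftyC 𝕜 L)
    {ε : ℝ} (hε : 0 ≤ ε) :
    ∃ J : Set (Set L), (∀ B ∈ J, B.Countable ∧ ε < var P B) ∧ J.PairwiseDisjoint id ∧
      ∀ z, ‖P (ind 𝕜 (⋃₀ J)ᶜ z)‖ ≤ ε * ‖z‖ := by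
  obtain ⟨J, hJ⟩ := zorn_subset
    {J : Set (Set L) | (∀ B ∈ J, B.Countable ∧ ε < var P B) ∧ J.PairwiseDisjoint id}
    (fun c hc hchain => ⟨⋃₀ c, ⟨fun B ⟨s, hs, hB⟩ => (hc hs).1 B hB,
      (Set.pairwiseDisjoint_sUnion hchain.directedOn).2 fun s hs => (hc hs).2⟩,
      fun s hs => Set.subset_sUnion_of_mem hs⟩)
  refine ⟨J, hJ.prop.1, hJ.prop.2, fun z => ?_⟩
  let y := ind 𝕜 (⋃₀ J)ᶜ z
  -- A countable set disjoint from all members of `J`: were its variation above `ε`, maximality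
  -- would put it in `J`, forcing it to be empty.
  let B : Set L := {i | y i ≠ 0}
  have hBdisj : ∀ i ∈ B, ∀ A ∈ J, i ∉ A := fun i hi A hA hiA =>
    hi (ind_apply_of_notMem (by simpa using ⟨A, hA, hiA⟩) z)
  have hB : var P B ≤ ε := by
    by_contra! hlt
    have hins : insert B J ∈
        {J : Set (Set L) | (∀ B ∈ J, B.Countable ∧ ε < var P B) ∧ J.PairwiseDisjoint id} := by
      refine ⟨fun A hA => ?_, hJ.prop.2.insert fun A hA _ => Set.disjoint_left.2 fun i hi =>
        hBdisj i hi A hA⟩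
      rcases hA with rfl | hA
      exacts [⟨y.countable_support, hlt⟩, hJ.prop.1 A hA]
    have hBJ : B ∈ J := hJ.le_of_ge hins (Set.subset_insert _ _) (Set.mem_insert _ _)
    have hempty : B = ∅ := Set.eq_empty_of_forall_notMem fun i hi => hBdisj i hi B hBJ hi
    refine hlt.not_ge (var_le hε fun x => ?_)
    have : ind 𝕜 B x = 0 := ext_apply fun i => by simp [ind, hempty]
    rw [this, map_zero, norm_zero]
    positivity
  calc ‖P y‖ ≤ var P B * ‖y‖ := norm_apply_le_var fun i hi => hi
    _ ≤ ε * ‖z‖ := by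
      gcongr
      exact norm_ind_apply_le _ z

theorem mk_sUnion_le_of_countable {L : Type u} (J : Set (Set L)) (hJ : ∀ B ∈ J, B.Countable) :
    #(⋃₀ J) ≤ max #J ℵ₀ := by
  refine (Cardinal.mk_sUnion_le J).trans ?_
  have h : ⨆ s : J, #s ≤ ℵ₀ := ciSup_le' fun s => Set.Countable.le_aleph0 (hJ s s.2)
  calc #J * ⨆ s : J, #s ≤ max #J ℵ₀ * max #J ℵ₀ :=
        mul_le_mul' (le_max_left _ _) (h.trans (le_max_right _ _))
    _ = max #J ℵ₀ := Cardinal.mul_eq_self (le_max_right _ _)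

theorem mk_le_of_pairwiseDisjoint {L : Type u} (J : Set (Set L)) (hJ : J.PairwiseDisjoint id)
    (hne : ∀ B ∈ J, B.Nonempty) : #J ≤ #L := by
  choose f hf using fun B : J => hne B B.2
  refine Cardinal.mk_le_of_injective (f := f) fun A B hAB => ?_
  by_contra hne
  exact Set.disjoint_left.1 (hJ A.2 B.2 fun h => hne (Subtype.ext h)) (hf A) (hAB ▸ hf B)

/-- Infinite-dimensional complemented subspaces of `EllInftyC 𝕜 L`. -/
theorem exists_isomorphic_of_complemented {L : Type u} [Infinite L] [CompleteSpace X]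
    (u : X →L[𝕜] EllInftyC 𝕜 L) (v : EllInftyC 𝕜 L →L[𝕜] X) (h : ∀ x, v (u x) = x)
    (hu : ∀ x, ‖u x‖ = ‖x‖) (hX : ¬ FiniteDimensional 𝕜 X) :
    ∃ κ : Cardinal.{u}, κ ≤ #L ∧ Nonempty (X ≃L[𝕜] EllInftyC 𝕜 κ.ord.ToType) := by
  obtain ⟨J, hJ, hdisj, hsmall⟩ := exists_disjoint_countable_family (u ∘L v)
    (ε := 1 / 2) (by norm_num)
  have hne : ∀ B ∈ J, B.Nonempty := fun B hB => by
    by_contra hemp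
    rw [Set.not_nonempty_iff_eq_empty] at hemp
    have h1 := (hJ B hB).2
    have h2 : var (u ∘L v) B ≤ 0 := var_le le_rfl fun z => by
      have : ind 𝕜 B z = 0 := ext_apply fun i => by simp [ind, hemp]
      simp [this]
    linarith
  refine ⟨max #J ℵ₀, max_le (mk_le_of_pairwiseDisjoint J hdisj hne) (Cardinal.aleph0_le_mk L), ?_⟩
  set K := (max #J ℵ₀).ord.ToType
  have hK : #K = max #J ℵ₀ := Cardinal.mk_ord_toType _
  have : Infinite K := Cardinal.infinite_iff.2 (hK ▸ le_max_right _ _)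
  set Γ := ⋃₀ J
  obtain ⟨e⟩ : Nonempty (Γ ↪ K) :=
    (hK ▸ mk_sUnion_le_of_countable J fun B hB => (hJ B hB).1 : #Γ ≤ #K)
  let s : Γ ↪ L := Function.Embedding.subtype (· ∈ Γ)
  -- The part of the identity of `X` lost by restricting to `Γ`; as `u` is isometric, the bound on
  -- `P` off `Γ` passes to `N`.
  let N : X →L[𝕜] X := v ∘L ind 𝕜 Γᶜ ∘L u
  have hN : ‖N‖ ≤ 1 / 2 := ContinuousLinearMap.opNorm_le_bound _ (by norm_num) fun x => by
    rw [← hu, ← hu x]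
    exact hsmall (u x)
  obtain ⟨S, hS⟩ := exists_leftInverse_id_sub N (hN.trans_lt (by norm_num))
  have hab : ∃ (a : EllInftyC 𝕜 K →L[𝕜] X) (b : X →L[𝕜] EllInftyC 𝕜 K), ∀ z, b (a z) = z := by
    -- An infinite `J` itself supplies the disjoint sets; for finite `J` they come from
    -- infinite-dimensionality.
    by_cases hfin : ℵ₀ ≤ #J
    · obtain ⟨f⟩ : Nonempty (K ≃ J) := Cardinal.eq.1 (hK.trans (max_eq_left hfin))
      exact exists_factorization u v (ε := 1 / 2) (by norm_num) (fun k => (f k : Set L))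
        (fun k l hkl => hdisj (f k).2 (f l).2 fun heq => hkl (f.injective (Subtype.ext heq)))
        fun k => (hJ _ (f k).2).2
    · have hKω : #K = ℵ₀ := hK.trans (max_eq_right (not_le.1 hfin).le)
      obtain ⟨hden⟩ := Cardinal.denumerable_iff.2 hKω
      let f : K ≃ ℕ := Denumerable.eqv K
      have hex := mt (finiteDimensional_of_exhaustive u v h) hX
      push Not at hex
      obtain ⟨ε, hε, A, hA, hlt⟩ := hex
      exact exists_factorization u v hε (fun k => A (f k))
        (fun k l hkl => hA fun heq => hkl (f.injective heq)) fun k => hlt _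
  obtain ⟨a, b, hab⟩ := hab
  refine isomorphic_of_complemented (extend 𝕜 e ∘L restr 𝕜 s ∘L u)
    (S ∘L v ∘L extend 𝕜 s ∘L restr 𝕜 e) (fun x => ?_) a b hab
  have h1 : v (ind 𝕜 Γ (u x)) = x - N x := by
    have : v (ind 𝕜 Γ (u x)) + N x = x := by
      rw [← h x]
      simp only [N, ContinuousLinearMap.comp_apply, h]
      rw [← map_add, ind_add_ind_compl, h]
    exact eq_sub_of_add_eq this
  simp only [ContinuousLinearMap.comp_apply, restr_extend]
  rw [extend_restr_subtype, h1, hS]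

theorem exists_isomorphic_of_closedComplemented {L : Type u} [Infinite L] {V : Type*}
    [NormedAddCommGroup V] [NormedSpace 𝕜 V] (E : EllInftyC 𝕜 L ≃L[𝕜] V) (hE : ∀ x, ‖E x‖ = ‖x‖)
    (X : Submodule 𝕜 V) (hX : X.ClosedComplemented) (hfin : ¬ FiniteDimensional 𝕜 X) :
    ∃ κ : Cardinal.{u}, κ ≤ #L ∧ Nonempty (X ≃L[𝕜] EllInftyC 𝕜 κ.ord.ToType) := by
  have : CompleteSpace V := (completeSpace_congr (e := E.toEquiv) E.isUniformEmbedding).1 inferInstance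
  have : CompleteSpace X := hX.isClosed.completeSpace_coe
  obtain ⟨v, hv⟩ := hX
  refine exists_isomorphic_of_complemented (E.symm.toContinuousLinearMap ∘L X.subtypeL)
    (v ∘L E.toContinuousLinearMap) (fun x => by simpa using hv x) (fun x => ?_) hfin
  rw [← hE]
  simp

/-- A complemented subspace of `EllInftyC 𝕜 L` is isomorphic to the whole space if the projection
does not vanish uniformly on a family of unit vectors of full cardinality. -/
theorem isomorphic_of_mk_eq {L : Type u} [Infinite L]
    (u : X →L[𝕜] EllInftyC 𝕜 L) (v : EllInftyC 𝕜 L →L[𝕜] X) (h : ∀ x, v (u x) = x) {ε : ℝ}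
    (hε : 0 < ε) (hcard : #{l : L | ε < var (u ∘L v) {l}} = #L) :
    Nonempty (X ≃L[𝕜] EllInftyC 𝕜 L) := by
  obtain ⟨f⟩ := Cardinal.eq.1 hcard.symm
  obtain ⟨a, b, hab⟩ := exists_factorization u v hε (fun l => {(f l : L)})
    (fun k l hkl => Set.disjoint_singleton.2 fun heq => hkl (f.injective (Subtype.ext heq)))
    fun l => (f l).2
  exact isomorphic_of_complemented u v h a b hab

open Classical in
/-- If `EllInftyC 𝕜 L` is decomposed into two summands, one of them is isomorphic to the whole
space. -/
theorem isomorphic_or_isomorphic {L : Type u} [Infinite L] {Y Z : Type*}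
    [NormedAddCommGroup Y] [NormedSpace 𝕜 Y] [NormedAddCommGroup Z] [NormedSpace 𝕜 Z]
    (e : EllInftyC 𝕜 L ≃L[𝕜] Y × Z) :
    Nonempty (Y ≃L[𝕜] EllInftyC 𝕜 L) ∨ Nonempty (Z ≃L[𝕜] EllInftyC 𝕜 L) := by
  let uY : Y →L[𝕜] EllInftyC 𝕜 L := e.symm.toContinuousLinearMap ∘L ContinuousLinearMap.inl 𝕜 Y Z
  let vY : EllInftyC 𝕜 L →L[𝕜] Y := ContinuousLinearMap.fst 𝕜 Y Z ∘L e.toContinuousLinearMap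
  let uZ : Z →L[𝕜] EllInftyC 𝕜 L := e.symm.toContinuousLinearMap ∘L ContinuousLinearMap.inr 𝕜 Y Z
  let vZ : EllInftyC 𝕜 L →L[𝕜] Z := ContinuousLinearMap.snd 𝕜 Y Z ∘L e.toContinuousLinearMap
  have hsum : ∀ z, uY (vY z) + uZ (vZ z) = z := fun z => by
    simp [uY, vY, uZ, vZ, ← map_add]
  -- The two images of a unit vector sum to it, so one has norm at least `1/2`.
  have hcover : ∀ l : L, 1 / 4 < var (uY ∘L vY) {l} ∨ 1 / 4 < var (uZ ∘L vZ) {l} := fun l => by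
    by_contra! hcon
    let z : EllInftyC 𝕜 L := mk (fun i => if i = l then 1 else 0)
      ⟨1, fun i => by by_cases hi : i = l <;> simp [hi]⟩
      ((Set.countable_singleton l).mono fun i hi => by simpa using hi)
    have hz : ‖z‖ ≤ 1 := norm_le zero_le_one fun i => by
      by_cases hi : i = l <;> simp [z, hi]
    have hzl : ∀ i, z i ≠ 0 → i ∈ ({l} : Set L) := fun i hi => by simpa [z] using hi
    have h1 : (1 : ℝ) = ‖z l‖ := by simp [z]
    have h2 : ‖z‖ ≤ ‖uY (vY z)‖ + ‖uZ (vZ z)‖ := by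
      conv_lhs => rw [← hsum z]
      exact norm_add_le _ _
    have h3 : ‖uY (vY z)‖ ≤ var (uY ∘L vY) {l} * ‖z‖ :=
      norm_apply_le_var (T := uY ∘L vY) hzl
    have h4 : ‖uZ (vZ z)‖ ≤ var (uZ ∘L vZ) {l} * ‖z‖ :=
      norm_apply_le_var (T := uZ ∘L vZ) hzl
    have h5 := norm_apply_le z l
    nlinarith
  have hle : #L ≤ #{l : L | 1 / 4 < var (uY ∘L vY) {l}} + #{l : L | 1 / 4 < var (uZ ∘L vZ) {l}} := by
    refine le_trans ?_ (Cardinal.mk_union_le _ _)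
    rw [← Cardinal.mk_univ]
    exact Cardinal.mk_le_mk_of_subset fun l _ => hcover l
  by_cases hY : #{l : L | 1 / 4 < var (uY ∘L vY) {l}} = #L
  · exact Or.inl (isomorphic_of_mk_eq uY vY (fun y => by simp [uY, vY]) (by norm_num) hY)
  by_cases hZ : #{l : L | 1 / 4 < var (uZ ∘L vZ) {l}} = #L
  · exact Or.inr (isomorphic_of_mk_eq uZ vZ (fun y => by simp [uZ, vZ]) (by norm_num) hZ)
  exact absurd hle (Cardinal.add_lt_of_lt (Cardinal.aleph0_le_mk L)
    ((Cardinal.mk_set_le _).lt_of_ne hY) ((Cardinal.mk_set_le _).lt_of_ne hZ)).not_ge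

end EllInftyC

theorem theorem1p4 (𝕜 : Type t) [RCLike 𝕜] (lam : Cardinal.{u}) (hlam : ℵ₀ ≤ lam) :
    (∀ X : Submodule 𝕜 (ellInftyCard 𝕜 lam), X.ClosedComplemented → ¬ FiniteDimensional 𝕜 X →
      Isomorphic 𝕜 X (lp (fun _ : ℕ => 𝕜) ∞) ∨
        ∃ κ : Cardinal.{u}, κ ≤ lam ∧ Isomorphic 𝕜 X (ellInftyCard 𝕜 κ)) ∧
    IsPrimary.{max u t, v, w, t} 𝕜 (ellInftyCard 𝕜 lam) := by
  let L := lam.ord.ToType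
  have hL : #L = lam := Cardinal.mk_ord_toType lam
  have : Infinite L := Cardinal.infinite_iff.2 (hL ▸ hlam)
  let E := EllInftyC.equiv 𝕜 L
  -- The case of `ℓ_∞` is covered by `κ = ℵ₀`, where countability of supports is no restriction.
  refine ⟨fun X ⟨v, hv⟩ hX => Or.inr ?_, fun Y Z _ _ _ _ _ _ ⟨e⟩ => ?_⟩
  · obtain ⟨κ, hκ, ⟨f⟩⟩ := EllInftyC.exists_isomorphic_of_closedComplemented E
      EllInftyC.norm_equiv X ⟨v, hv⟩ hX
    exact ⟨κ, hκ.trans_eq hL, ⟨f.trans (EllInftyC.equiv 𝕜 _)⟩⟩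
  · exact (EllInftyC.isomorphic_or_isomorphic (E.trans e)).imp
      (fun ⟨f⟩ => ⟨f.trans E⟩) (fun ⟨f⟩ => ⟨f.trans E⟩)
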